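/- **Notation.** $\log_+(x)=1+\max(0,\log x)$; $\mathbb D_r=\{\lambda\in\mathbb C:|\lambda|\le r\}$; $\|\cdot\|$ is the Euclidean norm of vectors and the operator norm of matrices, $\|\cdot\|_F$ the Frobenius norm. For a real square matrix $A$, $\kappa_{\rm diag}(A)=\inf\|H\|\,\|H^{-1}\|$ over invertible complex $H$ with $H^{-1}AH$ diagonal ($+\infty$ if there is none). Signals with a negative index are zero. **Algorithm.** Let $T\ge 2$, let $u_0,\dots,u_T\in\mathbb R^{d_{\rm in}}$ and $y_0,\dots,y_T\in\mathbb R^{d_{\rm out}}$ be arbitrary with $\|u_t\|,\|y_t\|\le R$, $R>0$. Let $(\sigma_i,\phi_i)_{i=1}^{T-1}$ be orthonormal eigenpairs, $\sigma_1\ge\sigma_2\ge\cdots$, of the $(T-1)\times(T-1)$ Hankel matrix with entries $\frac{2}{(i+j)^3-(i+j)}$. For matrices $\Theta=(J_1,\dots,J_{m-1},M_1,\dots,M_{\min(h,T-1)})$ of size $d_{\rm out}\times d_{\rm in}$ put $$z_t(\Theta)=y_{t-1}+\sum_{j=1}^{m-1}J_ju_{t-j}+\sum_{i=1}^{\min(h,T-1)}\sigma_i^{1/4}M_i\sum_{k=1}^{T-1}\phi_i(k)\,u_{t-1-k}$$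 (this is spectral filtering plus regression over inputs and outputs, with the autoregressive weights frozen to $P_1=I$, $P_j=0$ for $j>1$, $N=0$). Starting from any $\Theta^1$ with $\|\Theta^1\|_F\le D$, the algorithm predicts $\hat y_t$, the projection of $z_t(\Theta^t)$ to the ball of radius $R$, and updates $\Theta^{t+1}=\Pi_{\{\|\Theta\|_F\le D\}}[\Theta^t-\eta_t g_t]$ with $g_t$ a (sub)gradient at $\Theta^t$ of $\Theta\mapsto\|z_t(\Theta)-y_t\|$. **Comparators.** For $0<\gamma\le1$, $0\le\rho\le\gamma$ and $\kappa,R_B,R_C,R_{x_0}\ge0$ let $\Pi=\mathrm{LDS}(\rho,\gamma,\kappa,R_B,R_C,R_{x_0},R)$ be the class of predictors $\pi=(A,B,C,x_0)$, of any hidden dimension, where the real matrix $A$ is diagonalizable over $\mathbb C$ with all eigenvalues in $[0,1-\rho]\cup\{1\}\cup\mathbb D_{1-\gamma}$, $\kappa_{\rm diag}(A)\le\kappa$, $\|B\|_F\le R_B$, $\|C\|_F\le R_C$, $\|x_0\|\le R_{x_0}$, whose predictions add the increment of the system's output to the last observation, $$\hat y^\pi_t=y_{t-1}+Cx_t-Cx_{t-1},\qquad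 x_{t+1}=Ax_t+Bu_t,$$ and satisfy $\|\hat y_t^\pi\|\le R$ for $1\le t\le T$. **Lemma.** Run the algorithm with $h=\Theta(\log^2T)$, $m=\Theta\big(\frac1\gamma\log\frac T\gamma\big)$, $D=\Theta((m+h)R_BR_C\kappa)$ and nonincreasing $\eta_t=\Theta\big(\frac{R_BR_C\kappa}{R\sqrt t\log T}\big)$, where the lower constants for $h,m,D$ are at least a suitable absolute constant. If $\rho>0$, then for every $\pi\in\Pi$ $$\sum_{t=1}^T\|\hat y_t-y_t\|-\sum_{t=1}^T\|\hat y_t^\pi-y_t\|\le O\left(\frac{\log^7(T/\gamma)}{\gamma^2}\,R_BR_C\kappa R\sqrt T+\frac{R\,\log_+(R_C\kappa R_{x_0}/R)}{\rho}\right).$$ If $\rho=0$, the same holds with the second term replaced by $R_C\kappa R_{x_0}\big(\frac1\gamma+\log T\big)$. The constant in $O(\cdot)$ depends only on the constants in the $\Theta(\cdot)$'s; it does not depend on the dimensions, the signal or any other parameter. -/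

import Mathlib

noncomputable section

namespace OSF

/-- Vectors of `ℝᵈ`, with the Euclidean norm. -/
abbrev Vec (d : ℕ) := EuclideanSpace ℝ (Fin d)

/-- Multiplication of a vector by a real matrix. -/
def mulV {p q : ℕ} (M : Matrix (Fin p) (Fin q) ℝ) (v : Vec q) : Vec p :=
  WithLp.toLp 2 (M.mulVec v.ofLp)

/-- The Frobenius norm of a real matrix. -/
def frob {p q : ℕ} (M : Matrix (Fin p) (Fin q) ℝ) : ℝ :=
  √(∑ i, ∑ j, M i j ^ 2)

/-- `log₊ x = 1 + max (0, log x)`. -/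
def logPlus (x : ℝ) : ℝ := 1 + max 0 (Real.log x)

/-- The entry `v_{t-k}` of a signal; entries with a negative index are zero. -/
def lag {d : ℕ} (v : ℕ → Vec d) (t k : ℕ) : Vec d :=
  if k ≤ t then v (t - k) else 0

/-- Euclidean projection onto the closed ball of radius `r` around the origin. -/
def projBall {E : Type*} [NormedAddCommGroup E] [NormedSpace ℝ E] (r : ℝ) (x : E) : E :=
  open Classical in if ‖x‖ ≤ r then x else (r / ‖x‖) • x

/-! ### Spectral filters -/

/-- The `n × n` Hankel matrix with entries `2 / ((i + j)³ - (i + j))`, `1 ≤ i, j ≤ n`. -/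
def hankel (n : ℕ) : Matrix (Fin n) (Fin n) ℝ :=
  Matrix.of fun i j =>
    2 / ((((i : ℕ) + 1 : ℝ) + ((j : ℕ) + 1)) ^ 3 - (((i : ℕ) + 1 : ℝ) + ((j : ℕ) + 1)))

/-- `(σ i, φ i)` are orthonormal eigenpairs of the `n × n` Hankel matrix, in decreasing order of
the eigenvalues. -/
structure IsFilterBank (n : ℕ) (σ : Fin n → ℝ) (φ : Fin n → Vec n) : Prop where
  orthonormal : Orthonormal ℝ φ
  eigen : ∀ i, mulV (hankel n) (φ i) = σ i • φ i
  decreasing : Antitone σ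

/-- `⟨ψ, v_{t-a : t-a-n+1}⟩`: the convolution of the signal `v` with the filter `ψ`, starting at
the entry `v_{t-a}`. -/
def filtered {n d : ℕ} (ψ : Vec n) (v : ℕ → Vec d) (t a : ℕ) : Vec d :=
  ∑ k : Fin n, ψ k • lag v t (a + k)

/-! ### The algorithm -/

/-- The number of filters in use when `h` are asked for: there are only `T - 1` eigenpairs. -/
abbrev numFilters (T h : ℕ) : ℕ := min h (T - 1)

/-- The full set of weights `Θ = (J, M, P, N)` of a predictor; `J j` and `P j` here are
`J_{j+1}` and `P_{j+1}` in one-based numbering. -/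
structure Weights (T h m din dout : ℕ) where
  J : Fin (m - 1) → Matrix (Fin dout) (Fin din) ℝ
  M : Fin (numFilters T h) → Matrix (Fin dout) (Fin din) ℝ
  P : Fin m → Matrix (Fin dout) (Fin dout) ℝ
  N : Fin (numFilters T h) → Matrix (Fin dout) (Fin dout) ℝ

/-- The prediction at time `t` from the weights `Θ`, before projection. -/
def rawPrediction {T h m din dout : ℕ} (σ : Fin (T - 1) → ℝ) (φ : Fin (T - 1) → Vec (T - 1))
    (u : ℕ → Vec din) (y : ℕ → Vec dout) (Θ : Weights T h m din dout) (t : ℕ) : Vec dout :=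
  (∑ j, mulV (Θ.J j) (lag u t (j + 1)))
  + (∑ i, (σ (i.castLE (min_le_right _ _))) ^ (1 / 4 : ℝ) •
      mulV (Θ.M i) (filtered (φ (i.castLE (min_le_right _ _))) u t 2))
  + (∑ j, mulV (Θ.P j) (lag y t (j + 1)))
  + (∑ i, (σ (i.castLE (min_le_right _ _))) ^ (1 / 4 : ℝ) •
      mulV (Θ.N i) (filtered (φ (i.castLE (min_le_right _ _))) y t 1))

/-- The weights `(J, M)` that are learned when `P` and `N` are frozen, as one vector whose
Euclidean norm is the Frobenius norm of all the matrices together. -/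
abbrev Learned (T h m din dout : ℕ) :=
  EuclideanSpace ℝ ((Fin (m - 1) ⊕ Fin (numFilters T h)) × Fin dout × Fin din)

/-- Completes learned weights `(J, M)` by the frozen ones `P₁ = 1`, `P_j = 0` for `j > 1`,
`N = 0`. -/
def Learned.weights {T h m din dout : ℕ} (w : Learned T h m din dout) :
    Weights T h m din dout where
  J j := Matrix.of fun a b => w (Sum.inl j, a, b)
  M i := Matrix.of fun a b => w (Sum.inr i, a, b)
  P j := if (j : ℕ) = 0 then 1 else 0
  N _ := 0

/-- The loss `‖ŷ_t(Θ) - y_t‖` of the (linear, unprojected) predictor at time `t`. -/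
def loss {T h m din dout : ℕ} (σ : Fin (T - 1) → ℝ) (φ : Fin (T - 1) → Vec (T - 1))
    (u : ℕ → Vec din) (y : ℕ → Vec dout) (t : ℕ) (w : Learned T h m din dout) : ℝ :=
  ‖rawPrediction σ φ u y w.weights t - y t‖

/-- `g` is a subgradient of `f` at `x` (the gradient, where a convex `f` is differentiable). -/
def IsSubgradient {E : Type*} [NormedAddCommGroup E] [InnerProductSpace ℝ E]
    (f : E → ℝ) (x g : E) : Prop :=
  ∀ z, f x + inner ℝ g (z - x) ≤ f z

/-- `w 1, …, w T` are iterates of projected online (sub)gradient descent over the ball of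
radius `D` with step sizes `η`, from an arbitrary starting point of the ball. -/
structure IsRun {T h m din dout : ℕ} (σ : Fin (T - 1) → ℝ) (φ : Fin (T - 1) → Vec (T - 1))
    (u : ℕ → Vec din) (y : ℕ → Vec dout) (D : ℝ) (η : ℕ → ℝ)
    (w : ℕ → Learned T h m din dout) : Prop where
  init : ‖w 1‖ ≤ D
  step : ∀ t, 1 ≤ t → t < T → ∃ g, IsSubgradient (loss σ φ u y t) (w t) g ∧
    w (t + 1) = projBall D (w t - η t • g)

/-- The prediction announced at time `t`: projected to the ball of radius `R`. -/
def prediction {T h m din dout : ℕ} (σ : Fin (T - 1) → ℝ) (φ : Fin (T - 1) → Vec (T - 1))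
    (u : ℕ → Vec din) (y : ℕ → Vec dout) (R : ℝ) (w : ℕ → Learned T h m din dout) (t : ℕ) :
    Vec dout :=
  projBall R (rawPrediction σ φ u y (w t).weights t)

/-! ### The comparator class -/

/-- Linear dynamical systems `x_{t+1} = A x_t + B u_t`, `y_t = C x_t` with initial state `x₀`,
of arbitrary hidden dimension. -/
structure LDS (din dout : ℕ) where
  dim : ℕ
  A : Matrix (Fin dim) (Fin dim) ℝ
  B : Matrix (Fin dim) (Fin din) ℝ
  C : Matrix (Fin dout) (Fin dim) ℝ
  x₀ : Vec dim

/-- The hidden state at time `t`, driven by the inputs `u`. -/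
def LDS.state {din dout : ℕ} (S : LDS din dout) (u : ℕ → Vec din) : ℕ → Vec S.dim
  | 0 => S.x₀
  | t + 1 => mulV S.A (LDS.state S u t) + mulV S.B (u t)

/-- The output of the system at time `t`. -/
def LDS.output {din dout : ℕ} (S : LDS din dout) (u : ℕ → Vec din) (t : ℕ) : Vec dout :=
  mulV S.C (S.state u t)

/-- The prediction of the LDS predictor at time `t ≥ 1`: the last observation plus the increment
of the system's output. -/
def LDS.predict {din dout : ℕ} (S : LDS din dout) (u : ℕ → Vec din) (y : ℕ → Vec dout)
    (t : ℕ) : Vec dout :=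
  y (t - 1) + (S.output u t - S.output u (t - 1))

/-- Operator norm of a complex matrix for the Euclidean norm. -/
def opNorm {d : ℕ} (H : Matrix (Fin d) (Fin d) ℂ) : ℝ :=
  ‖Matrix.toEuclideanCLM (n := Fin d) (𝕜 := ℂ) H‖

/-- The spectral condition number: the infimum of `‖H‖ ‖H⁻¹‖` over all invertible complex `H`
such that `A = H D H⁻¹` with `D` diagonal; it is `⊤` if `A` is not diagonalizable over `ℂ`. -/
def kappaDiag {d : ℕ} (A : Matrix (Fin d) (Fin d) ℝ) : ENNReal :=
  ⨅ (H : Matrix (Fin d) (Fin d) ℂ) (_ : IsUnit H.det ∧ ∃ D : Fin d → ℂ,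
    A.map Complex.ofReal = H * Matrix.diagonal D * H⁻¹), ENNReal.ofReal (opNorm H * opNorm H⁻¹)

/-- `[0, 1 - ρ] ∪ {1} ∪ {|z| ≤ 1 - γ}`. -/
def spectralRegion (ρ γ : ℝ) : Set ℂ :=
  (Complex.ofReal '' Set.Icc 0 (1 - ρ)) ∪ {1} ∪ {z | ‖z‖ ≤ 1 - γ}

/-- The class `LDS(ρ, γ, κ, R_B, R_C, R_{x₀}, R)` of LDS predictors, on the signal `(u, y)` with
horizon `T`. -/
structure InClass {din dout : ℕ} (T : ℕ) (u : ℕ → Vec din) (y : ℕ → Vec dout)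
    (ρ γ κ RB RC Rx R : ℝ) (S : LDS din dout) : Prop where
  spectrum_subset : spectrum ℂ (S.A.map Complex.ofReal) ⊆ spectralRegion ρ γ
  kappa_le : kappaDiag S.A ≤ ENNReal.ofReal κ
  B_le : frob S.B ≤ RB
  C_le : frob S.C ≤ RC
  x₀_le : ‖S.x₀‖ ≤ Rx
  predict_le : ∀ t, 1 ≤ t → t ≤ T → ‖S.predict u y t‖ ≤ R

/-- The regret over the times `1, …, T` of the predictions `yhat` against the predictor `S`. -/
def regret {din dout : ℕ} (T : ℕ) (u : ℕ → Vec din) (y yhat : ℕ → Vec dout)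
    (S : LDS din dout) : ℝ :=
  (∑ t ∈ Finset.Icc 1 T, ‖yhat t - y t‖) - ∑ t ∈ Finset.Icc 1 T, ‖S.predict u y t - y t‖

end OSF

end

noncomputable section

namespace OSF

/-! ### Frobenius norms -/

/-! Differencing a linear dynamical system replaces its kernel `C Aᵏ B` by `C Aᵏ (A - 1) B`, so
after diagonalization an eigenvalue `λ` enters only through `λᵏ (λ - 1)`. This vanishes at `λ = 1`,
which is why marginally stable systems are learned with the autoregressive weights frozen. The
argument shows that the class is imitated by learned weights of bounded norm, and then applies the
regret bound of online subgradient descent.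

Imitation. Eigenvalues outside `[0, 1]` have modulus at most `1 - γ`: their kernel decays
geometrically, and the regression matrices `J` reproduce it up to a negligible tail. For `λ ∈ [0,
1]` the kernel is minus the vector `((1 - λ) λᵏ)ₖ`, and the Hankel matrix is the integral over `[0,
1]` of the outer squares of these vectors. Expanding in its eigenbasis gives the coefficients `-gen
(φ i) λ`. Three facts about an eigenpair carry the proof: `|gen (φ i) λ| ≤ 2 σᵢ^(1/4)` (from
`gen_pow_four_le`), so that the rescaled weights `M i` are bounded; `σᵢ` decays exponentially in
`√i` (`IsFilterBank.eigenvalue_le`), so that `log² T` filters suffice; and `σᵢ^(1/4) ‖φ i‖₁ = O(log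
T)` (`IsFilterBank.sqrt_mul_sum_abs_sq_le`), so that the gradients are bounded. The outcome is
`exists_comparator`, with error `O(R_B R_C κ R / T)` per step besides the transient of `x₀`.

Transient. It has size `R_C κ R_{x₀} sup |λˢ (λ - 1)|`. If `ρ = 0`, the supremum is at most `1/(s+1)
+ 2(1-γ)ˢ`, with sum `O(log T + 1/γ)`. If `ρ > 0`, it is at most `2(1-ρ)ˢ`; the first `log₊(R_C κ
R_{x₀}/R)/ρ` steps are charged `2R` each, after which the transient is of order `R` and sums to
`O(R/ρ)`. This is why regret is bounded from an arbitrary starting time (`sum_prediction_sub_le`).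
-/

/-- The Frobenius norm of a complex matrix. -/
def cfrob {p q : ℕ} (M : Matrix (Fin p) (Fin q) ℂ) : ℝ :=
  √(∑ i, ∑ j, ‖M i j‖ ^ 2)

lemma cfrob_nonneg {p q : ℕ} (M : Matrix (Fin p) (Fin q) ℂ) : 0 ≤ cfrob M := Real.sqrt_nonneg _

lemma frob_nonneg {p q : ℕ} (M : Matrix (Fin p) (Fin q) ℝ) : 0 ≤ frob M := Real.sqrt_nonneg _

lemma frob_sq {p q : ℕ} (M : Matrix (Fin p) (Fin q) ℝ) : frob M ^ 2 = ∑ i, ∑ j, M i j ^ 2 :=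
  Real.sq_sqrt (by positivity)

lemma cfrob_sq {p q : ℕ} (M : Matrix (Fin p) (Fin q) ℂ) :
    cfrob M ^ 2 = ∑ i, ∑ j, ‖M i j‖ ^ 2 :=
  Real.sq_sqrt (by positivity)

lemma cfrob_map_ofReal {p q : ℕ} (M : Matrix (Fin p) (Fin q) ℝ) :
    cfrob (M.map Complex.ofReal) = frob M := by
  simp [cfrob, frob]

lemma frob_map_re_le {p q : ℕ} (M : Matrix (Fin p) (Fin q) ℂ) :
    frob (M.map Complex.re) ≤ cfrob M := by
  refine Real.sqrt_le_sqrt (Finset.sum_le_sum fun i _ => Finset.sum_le_sum fun j _ => ?_)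
  rw [Matrix.map_apply, ← sq_abs]
  gcongr
  exact Complex.abs_re_le_norm _

/-- Holds column by column. The constant `c` is left free because it is used both with the Frobenius
norm (for `C`) and with the operator norm (for the diagonalized matrix). -/
lemma cfrob_mul_le_of_bound {p q r : ℕ} (M : Matrix (Fin p) (Fin q) ℂ)
    (N : Matrix (Fin q) (Fin r) ℂ) {c : ℝ} (hc : 0 ≤ c)
    (hM : ∀ v : EuclideanSpace ℂ (Fin q), ‖WithLp.toLp 2 (M.mulVec v.ofLp)‖ ≤ c * ‖v‖) :
    cfrob (M * N) ≤ c * cfrob N := by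
  refine Real.sqrt_le_iff.2 ⟨mul_nonneg hc (cfrob_nonneg N), ?_⟩
  rw [mul_pow, cfrob_sq, Finset.sum_comm, Finset.sum_comm (f := fun i j => ‖N i j‖ ^ 2),
    Finset.mul_sum]
  refine Finset.sum_le_sum fun j _ => ?_
  have h := hM (WithLp.toLp 2 fun i => N i j)
  have h2 := pow_le_pow_left₀ (norm_nonneg _) h 2
  rw [mul_pow, EuclideanSpace.norm_sq_eq, EuclideanSpace.norm_sq_eq] at h2
  simpa [Matrix.mul_apply, Matrix.mulVec, dotProduct] using h2

lemma norm_mulVec_le_cfrob {p q : ℕ} (M : Matrix (Fin p) (Fin q) ℂ)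
    (v : EuclideanSpace ℂ (Fin q)) :
    ‖WithLp.toLp 2 (M.mulVec v.ofLp)‖ ≤ cfrob M * ‖v‖ := by
  rw [← Real.sqrt_sq (norm_nonneg (WithLp.toLp 2 (M.mulVec v.ofLp) : EuclideanSpace ℂ (Fin p)))]
  refine Real.sqrt_le_iff.2 ⟨mul_nonneg (cfrob_nonneg M) (norm_nonneg _), ?_⟩
  rw [mul_pow, cfrob_sq, EuclideanSpace.norm_sq_eq, EuclideanSpace.norm_sq_eq, Finset.sum_mul]
  refine Finset.sum_le_sum fun i _ => ?_
  calc ‖(M.mulVec v.ofLp) i‖ ^ 2 ≤ (∑ j, ‖M i j‖ * ‖v j‖) ^ 2 := by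
        gcongr
        simp only [Matrix.mulVec, dotProduct, ← norm_mul]
        exact norm_sum_le _ _
    _ ≤ _ := Finset.sum_mul_sq_le_sq_mul_sq _ _ _

lemma norm_mulV_le {p q : ℕ} (M : Matrix (Fin p) (Fin q) ℝ) (v : Vec q) :
    ‖mulV M v‖ ≤ frob M * ‖v‖ := by
  rw [← Real.sqrt_sq (norm_nonneg (mulV M v))]
  refine Real.sqrt_le_iff.2 ⟨mul_nonneg (frob_nonneg M) (norm_nonneg _), ?_⟩
  rw [mul_pow, frob_sq, EuclideanSpace.norm_sq_eq, EuclideanSpace.norm_sq_eq, Finset.sum_mul]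
  refine Finset.sum_le_sum fun i _ => ?_
  have := Finset.sum_mul_sq_le_sq_mul_sq Finset.univ (fun j => M i j) (fun j => v j)
  simpa [mulV, Matrix.mulVec, dotProduct] using this

lemma opNorm_nonneg {d : ℕ} (H : Matrix (Fin d) (Fin d) ℂ) : 0 ≤ opNorm H := norm_nonneg _

lemma norm_mulVec_le_opNorm {d : ℕ} (H : Matrix (Fin d) (Fin d) ℂ)
    (v : EuclideanSpace ℂ (Fin d)) :
    ‖WithLp.toLp 2 (H.mulVec v.ofLp)‖ ≤ opNorm H * ‖v‖ :=
  (Matrix.toEuclideanCLM (n := Fin d) (𝕜 := ℂ) H).le_opNorm v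

lemma opNorm_mul_le {d : ℕ} (G H : Matrix (Fin d) (Fin d) ℂ) :
    opNorm (G * H) ≤ opNorm G * opNorm H := by
  unfold opNorm
  rw [map_mul]
  exact norm_mul_le _ _

open scoped Matrix.Norms.L2Operator in
lemma opNorm_diagonal_le {d : ℕ} (f : Fin d → ℂ) {s : ℝ} (hs : 0 ≤ s) (hf : ∀ l, ‖f l‖ ≤ s) :
    opNorm (Matrix.diagonal f) ≤ s := by
  have : opNorm (Matrix.diagonal f) = ‖f‖ := by
    unfold opNorm
    rw [Matrix.l2_opNorm_toEuclideanCLM, Matrix.l2_opNorm_diagonal]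
  rw [this]
  exact (pi_norm_le_iff_of_nonneg hs).2 hf

/-! ### Multiplication of vectors by matrices -/

lemma mulV_add {p q : ℕ} (M : Matrix (Fin p) (Fin q) ℝ) (v w : Vec q) :
    mulV M (v + w) = mulV M v + mulV M w := by
  simp [mulV, Matrix.mulVec_add]

lemma mulV_sub {p q : ℕ} (M : Matrix (Fin p) (Fin q) ℝ) (v w : Vec q) :
    mulV M (v - w) = mulV M v - mulV M w := by
  simp [mulV, Matrix.mulVec_sub]

lemma mulV_smul {p q : ℕ} (M : Matrix (Fin p) (Fin q) ℝ) (c : ℝ) (v : Vec q) :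
    mulV M (c • v) = c • mulV M v := by
  simp [mulV, Matrix.mulVec_smul]

lemma mulV_zero {p q : ℕ} (M : Matrix (Fin p) (Fin q) ℝ) : mulV M 0 = 0 := by
  simp [mulV]

lemma mulV_sum {p q : ℕ} {ι : Type*} (s : Finset ι) (M : Matrix (Fin p) (Fin q) ℝ)
    (v : ι → Vec q) : mulV M (∑ i ∈ s, v i) = ∑ i ∈ s, mulV M (v i) := by
  classical
  induction s using Finset.induction_on with
  | empty => simp [mulV_zero]
  | insert a s ha ih => rw [Finset.sum_insert ha, Finset.sum_insert ha, mulV_add, ih]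

lemma add_mulV {p q : ℕ} (M N : Matrix (Fin p) (Fin q) ℝ) (v : Vec q) :
    mulV (M + N) v = mulV M v + mulV N v := by
  simp [mulV, Matrix.add_mulVec]

lemma sub_mulV {p q : ℕ} (M N : Matrix (Fin p) (Fin q) ℝ) (v : Vec q) :
    mulV (M - N) v = mulV M v - mulV N v := by
  simp [mulV, Matrix.sub_mulVec]

lemma smul_mulV {p q : ℕ} (c : ℝ) (M : Matrix (Fin p) (Fin q) ℝ) (v : Vec q) :
    mulV (c • M) v = c • mulV M v := by
  simp [mulV, Matrix.smul_mulVec]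

lemma zero_mulV {p q : ℕ} (v : Vec q) : mulV (0 : Matrix (Fin p) (Fin q) ℝ) v = 0 := by
  simp [mulV]

lemma one_mulV {p : ℕ} (v : Vec p) : mulV (1 : Matrix (Fin p) (Fin p) ℝ) v = v := by
  simp [mulV]

lemma sum_mulV {p q : ℕ} {ι : Type*} (s : Finset ι) (M : ι → Matrix (Fin p) (Fin q) ℝ)
    (v : Vec q) : mulV (∑ i ∈ s, M i) v = ∑ i ∈ s, mulV (M i) v := by
  classical
  induction s using Finset.induction_on with
  | empty => simp [zero_mulV]
  | insert a s ha ih => rw [Finset.sum_insert ha, Finset.sum_insert ha, add_mulV, ih]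

lemma mul_mulV {p q r : ℕ} (M : Matrix (Fin p) (Fin q) ℝ) (N : Matrix (Fin q) (Fin r) ℝ)
    (v : Vec r) : mulV (M * N) v = mulV M (mulV N v) := by
  simp [mulV, Matrix.mulVec_mulVec]

/-! ### Functional calculus of a diagonalized matrix, between a read-out and an input matrix -/

/-- The real part of `C H diag(f) H⁻¹ B`, as a real-linear function of `f`. -/
def transfer {p d q : ℕ} (C : Matrix (Fin p) (Fin d) ℝ) (H : Matrix (Fin d) (Fin d) ℂ)
    (B : Matrix (Fin d) (Fin q) ℝ) : (Fin d → ℂ) →ₗ[ℝ] Matrix (Fin p) (Fin q) ℝ where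
  toFun f := ((C.map Complex.ofReal) * ((H * Matrix.diagonal f * H⁻¹) *
    (B.map Complex.ofReal))).map Complex.re
  map_add' f g := by
    have : Matrix.diagonal (f + g) = Matrix.diagonal f + Matrix.diagonal g :=
      (Matrix.diagonal_add f g).symm
    rw [this, Matrix.mul_add, Matrix.add_mul, Matrix.add_mul, Matrix.mul_add]
    ext i j
    simp
  map_smul' c f := by
    have : Matrix.diagonal (c • f) = c • Matrix.diagonal f := by
      rw [Matrix.diagonal_smul]
    rw [this, Matrix.mul_smul, Matrix.smul_mul, Matrix.smul_mul, Matrix.mul_smul]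
    ext i j
    simp

/-- The source of the factor `R_B R_C κ` in every bound: a function of the eigenvalues costs its
supremum times the condition number of `H`, and taking real parts entrywise does not increase the
Frobenius norm. -/
lemma frob_transfer_le {p d q : ℕ} (C : Matrix (Fin p) (Fin d) ℝ) (H : Matrix (Fin d) (Fin d) ℂ)
    (B : Matrix (Fin d) (Fin q) ℝ) (f : Fin d → ℂ) {s : ℝ} (hs : 0 ≤ s) (hf : ∀ l, ‖f l‖ ≤ s) :
    frob (transfer C H B f) ≤ frob C * (opNorm H * opNorm H⁻¹) * frob B * s := by
  have h1 : opNorm (H * Matrix.diagonal f * H⁻¹) ≤ opNorm H * opNorm H⁻¹ * s := by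
    refine (opNorm_mul_le _ _).trans ?_
    have := (opNorm_mul_le H (Matrix.diagonal f)).trans
      (mul_le_mul_of_nonneg_left (opNorm_diagonal_le f hs hf) (opNorm_nonneg H))
    nlinarith [opNorm_nonneg H⁻¹]
  refine (frob_map_re_le _).trans ?_
  refine (cfrob_mul_le_of_bound _ _ (cfrob_nonneg _) (norm_mulVec_le_cfrob _)).trans ?_
  have h2 := cfrob_mul_le_of_bound (H * Matrix.diagonal f * H⁻¹) (B.map Complex.ofReal)
    (opNorm_nonneg _) (norm_mulVec_le_opNorm _)
  rw [cfrob_map_ofReal] at h2 ⊢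
  calc _ ≤ frob C * (opNorm (H * Matrix.diagonal f * H⁻¹) * frob B) :=
        mul_le_mul_of_nonneg_left h2 (frob_nonneg C)
    _ ≤ frob C * ((opNorm H * opNorm H⁻¹ * s) * frob B) := by
        have := frob_nonneg C
        have := frob_nonneg B
        gcongr
    _ = _ := by ring

lemma diagonalization_pow {d : ℕ} {A H : Matrix (Fin d) (Fin d) ℂ} {D : Fin d → ℂ}
    (hH : IsUnit H.det) (hA : A = H * Matrix.diagonal D * H⁻¹) (k : ℕ) :
    A ^ k = H * Matrix.diagonal (fun l => D l ^ k) * H⁻¹ := by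
  have h1 : H⁻¹ * H = 1 := Matrix.nonsing_inv_mul H hH
  have h2 : H * H⁻¹ = 1 := Matrix.mul_nonsing_inv H hH
  induction k with
  | zero => simp [h2]
  | succ k ih =>
    rw [pow_succ, ih, hA]
    calc _ = H * Matrix.diagonal (fun l => D l ^ k) * (H⁻¹ * H) * Matrix.diagonal D * H⁻¹ := by
          simp only [Matrix.mul_assoc]
      _ = _ := by
          rw [h1, Matrix.mul_one, Matrix.mul_assoc H, Matrix.diagonal_mul_diagonal]
          simp only [pow_succ]

lemma map_re_map_ofReal {p q : ℕ} (M : Matrix (Fin p) (Fin q) ℝ) :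
    (M.map Complex.ofReal).map Complex.re = M := by
  ext i j; simp

lemma map_ofReal_mul {p q r : ℕ} (M : Matrix (Fin p) (Fin q) ℝ) (N : Matrix (Fin q) (Fin r) ℝ) :
    (M * N).map Complex.ofReal = M.map Complex.ofReal * N.map Complex.ofReal :=
  Matrix.map_mul (f := Complex.ofRealHom)

lemma map_ofReal_pow {d : ℕ} (M : Matrix (Fin d) (Fin d) ℝ) (k : ℕ) :
    (M ^ k).map Complex.ofReal = M.map Complex.ofReal ^ k :=
  map_pow (Complex.ofRealHom.mapMatrix) M k

/-- `C Aᵏ B` is already real, so the real part in `transfer` loses nothing on powers. Thanks to it,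
the kernel can be split over the eigenvalues without tracking conjugate pairs. -/
lemma transfer_pow {p d q : ℕ} (C : Matrix (Fin p) (Fin d) ℝ) {A : Matrix (Fin d) (Fin d) ℝ}
    {H : Matrix (Fin d) (Fin d) ℂ} {D : Fin d → ℂ} (hH : IsUnit H.det)
    (hA : A.map Complex.ofReal = H * Matrix.diagonal D * H⁻¹) (B : Matrix (Fin d) (Fin q) ℝ)
    (k : ℕ) : transfer C H B (fun l => D l ^ k) = C * (A ^ k * B) := by
  have : transfer C H B (fun l => D l ^ k) = ((C.map Complex.ofReal) *
    ((H * Matrix.diagonal (fun l => D l ^ k) * H⁻¹) * (B.map Complex.ofReal))).map Complex.re := rfl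
  rw [this, ← diagonalization_pow hH hA, ← map_ofReal_pow, ← map_ofReal_mul, ← map_ofReal_mul,
    map_re_map_ofReal]

lemma transfer_pow_mul_sub_one {p d q : ℕ} (C : Matrix (Fin p) (Fin d) ℝ)
    {A : Matrix (Fin d) (Fin d) ℝ} {H : Matrix (Fin d) (Fin d) ℂ} {D : Fin d → ℂ}
    (hH : IsUnit H.det) (hA : A.map Complex.ofReal = H * Matrix.diagonal D * H⁻¹)
    (B : Matrix (Fin d) (Fin q) ℝ) (k : ℕ) :
    transfer C H B (fun l => D l ^ k * (D l - 1)) = C * (A ^ (k + 1) * B) - C * (A ^ k * B) := by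
  have : (fun l => D l ^ k * (D l - 1)) = (fun l => D l ^ (k + 1)) - fun l => D l ^ k := by
    ext l; simp only [Pi.sub_apply]; ring
  rw [this, map_sub, transfer_pow C hH hA, transfer_pow C hH hA]

lemma eigenvalue_mem_spectrum {d : ℕ} {A H : Matrix (Fin d) (Fin d) ℂ} {D : Fin d → ℂ}
    (hH : IsUnit H.det) (hA : A = H * Matrix.diagonal D * H⁻¹) (l : Fin d) :
    D l ∈ spectrum ℂ A := by
  obtain ⟨U, rfl⟩ := (Matrix.isUnit_iff_isUnit_det H).2 hH
  rw [hA, ← Matrix.coe_units_inv, spectrum.units_conjugate, spectrum_diagonal]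
  exact ⟨l, rfl⟩

/-- A diagonalization whose condition number is within a factor two of the bound. -/
lemma exists_diagonalization {d : ℕ} (A : Matrix (Fin d) (Fin d) ℝ) {κ : ℝ} (hκ : 0 ≤ κ)
    (hA : kappaDiag A ≤ ENNReal.ofReal κ) :
    ∃ (H : Matrix (Fin d) (Fin d) ℂ) (D : Fin d → ℂ), IsUnit H.det ∧
      A.map Complex.ofReal = H * Matrix.diagonal D * H⁻¹ ∧ opNorm H * opNorm H⁻¹ ≤ 2 * κ := by
  have key : ∀ ε : ℝ, 0 < ε → ∃ (H : Matrix (Fin d) (Fin d) ℂ) (D : Fin d → ℂ), IsUnit H.det ∧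
      A.map Complex.ofReal = H * Matrix.diagonal D * H⁻¹ ∧ opNorm H * opNorm H⁻¹ < κ + ε := by
    intro ε hε
    have h1 : kappaDiag A < ENNReal.ofReal (κ + ε) :=
      hA.trans_lt ((ENNReal.ofReal_lt_ofReal_iff (by linarith)).2 (by linarith))
    obtain ⟨H, h2⟩ := iInf_lt_iff.1 h1
    obtain ⟨⟨hH, D, hD⟩, h3⟩ := iInf_lt_iff.1 h2
    exact ⟨H, D, hH, hD, (ENNReal.ofReal_lt_ofReal_iff (by linarith)).1 h3⟩
  -- The infimum need not be attained, so a slack `ε = κ` is spent. For `κ = 0` there is no such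
  -- slack; but a condition number is at least `1` unless the dimension is zero.
  rcases hκ.eq_or_lt with h0 | hpos
  · obtain ⟨H, D, hH, hD, h⟩ := key 1 one_pos
    refine ⟨H, D, hH, hD, ?_⟩
    rcases d with _ | d
    · have : opNorm H = 0 := by
        unfold opNorm
        rw [Subsingleton.elim (Matrix.toEuclideanCLM (n := Fin 0) (𝕜 := ℂ) H) 0, norm_zero]
      rw [this, ← h0]; simp
    · exfalso
      have h1 : (1 : ℝ) ≤ opNorm H * opNorm H⁻¹ := by
        refine le_trans (le_of_eq ?_) (opNorm_mul_le H H⁻¹)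
        unfold opNorm
        rw [Matrix.mul_nonsing_inv H hH, map_one, norm_one]
      linarith
  · obtain ⟨H, D, hH, hD, h⟩ := key κ hpos
    exact ⟨H, D, hH, hD, by linarith⟩

/-! ### Spectral theory of the Hankel matrix -/

/-- The pairing of `x` with the vector `((1 - α) αᵏ)ₖ`. -/
def gen {n : ℕ} (x : Vec n) (α : ℝ) : ℝ := ∑ k : Fin n, x k * ((1 - α) * α ^ (k : ℕ))

/-- The derivative of `gen x`. -/
def genDeriv {n : ℕ} (x : Vec n) (α : ℝ) : ℝ :=
  ∑ k : Fin n, x k * ((1 - α) * ((k : ℕ) * α ^ ((k : ℕ) - 1)) - α ^ (k : ℕ))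

lemma hasDerivAt_gen {n : ℕ} (x : Vec n) (α : ℝ) : HasDerivAt (gen x) (genDeriv x α) α := by
  unfold gen genDeriv
  refine HasDerivAt.fun_sum fun k _ => HasDerivAt.const_mul _ ?_
  have h1 : HasDerivAt (fun α : ℝ => 1 - α) (-1) α := by
    simpa using (hasDerivAt_id α).const_sub 1
  convert h1.fun_mul (hasDerivAt_pow (k : ℕ) α) using 1
  ring

lemma continuous_gen {n : ℕ} (x : Vec n) : Continuous (gen x) := by
  unfold gen
  fun_prop

/-- With zero-based indices `p = i + j`, the one-based index sum in the Hankel entry is `p + 2`. -/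
lemma integral_one_sub_sq_mul_pow (p : ℕ) :
    ∫ α in (0 : ℝ)..1, (1 - α) ^ 2 * α ^ p =
      2 / (((p : ℝ) + 2) ^ 3 - ((p : ℝ) + 2)) := by
  have : ∀ α : ℝ, (1 - α) ^ 2 * α ^ p = α ^ p - 2 * α ^ (p + 1) + α ^ (p + 2) := by
    intro α; ring
  simp_rw [this]
  rw [intervalIntegral.integral_add (Continuous.intervalIntegrable (by fun_prop) _ _)
      (Continuous.intervalIntegrable (by fun_prop) _ _),
    intervalIntegral.integral_sub (Continuous.intervalIntegrable (by fun_prop) _ _)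
      (Continuous.intervalIntegrable (by fun_prop) _ _),
    intervalIntegral.integral_const_mul, integral_pow, integral_pow, integral_pow]
  have h : ((p : ℝ) + 2) ^ 3 - ((p : ℝ) + 2) = (p + 1) * (p + 2) * (p + 3) := by ring
  rw [h]
  push_cast
  simp only [one_pow, ne_eq, Nat.add_eq_zero_iff, one_ne_zero, and_false, not_false_eq_true,
    zero_pow, OfNat.ofNat_ne_zero, sub_zero]
  field_simp
  ring

/-- The Hankel matrix is the Gram integral of the vectors `((1 - α) αᵏ)ₖ` over `α ∈ [0, 1]`;
everything about its spectrum below is read off from this quadratic form. -/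
lemma inner_hankel {n : ℕ} (x : Vec n) :
    inner ℝ x (mulV (hankel n) x) = ∫ α in (0 : ℝ)..1, gen x α ^ 2 := by
  have h : ∀ α, gen x α ^ 2 =
      ∑ i : Fin n, ∑ j : Fin n, (x i * x j) * ((1 - α) ^ 2 * α ^ ((i : ℕ) + (j : ℕ))) := by
    intro α
    rw [sq, gen, Finset.sum_mul_sum]
    refine Finset.sum_congr rfl fun i _ => Finset.sum_congr rfl fun j _ => ?_
    rw [pow_add]; ring
  simp_rw [h]
  rw [intervalIntegral.integral_finsetSum fun i _ => by
    exact Continuous.intervalIntegrable (by fun_prop) _ _]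
  simp only [PiLp.inner_apply, mulV, Matrix.mulVec, dotProduct]
  refine Finset.sum_congr rfl fun i _ => ?_
  rw [intervalIntegral.integral_finsetSum fun i _ => by
    exact Continuous.intervalIntegrable (by fun_prop) _ _]
  simp only [RCLike.inner_apply, conj_trivial]
  rw [Finset.sum_mul]
  refine Finset.sum_congr rfl fun j _ => ?_
  rw [intervalIntegral.integral_const_mul, integral_one_sub_sq_mul_pow]
  simp only [hankel, Matrix.of_apply]
  have e : ((i : ℕ) : ℝ) + 1 + (((j : ℕ) : ℝ) + 1) = (((i : ℕ) + (j : ℕ) : ℕ) : ℝ) + 2 := by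
    push_cast; ring
  rw [e]
  ring

/-! ### Pointwise bound on generating functions of unit vectors by their mean square. -/

lemma one_sub_mul_geom_sum_le {α : ℝ} (h0 : 0 ≤ α) (n : ℕ) :
    (1 - α) * ∑ k : Fin n, α ^ (k : ℕ) ≤ 1 := by
  rw [Fin.sum_univ_eq_sum_range (fun k => α ^ k) n, mul_neg_geom_sum]
  have := pow_nonneg h0 n
  linarith

lemma one_sub_sq_mul_sum_le {α : ℝ} (h0 : 0 ≤ α) (h1 : α ≤ 1) (n : ℕ) :
    (1 - α) ^ 2 * ∑ k : Fin n, ((k : ℕ) * α ^ ((k : ℕ) - 1)) ≤ 1 := by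
  rw [Fin.sum_univ_eq_sum_range (fun k => (k : ℝ) * α ^ (k - 1)) n]
  rcases n with _ | n
  · simp
  have : (1 - α) ^ 2 * ∑ k ∈ Finset.range (n + 1), ((k : ℝ) * α ^ (k - 1)) =
      1 - α ^ n - n * α ^ n * (1 - α) := by
    induction n with
    | zero => simp
    | succ n ih =>
      rw [Finset.sum_range_succ, mul_add, ih]
      push_cast
      ring
  rw [this]
  have := pow_nonneg h0 n
  have : 0 ≤ n * α ^ n * (1 - α) := by
    have := sub_nonneg.2 h1
    positivity
  linarith

/-- `α^(k-1)` is the least term of the geometric sum over `j < k`. The same inequality later gives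
the `1/(s+1)` decay of the transient. -/
lemma mul_pow_pred_mul_one_sub_le {α : ℝ} (h0 : 0 ≤ α) (h1 : α ≤ 1) (k : ℕ) :
    (1 - α) * (k * α ^ (k - 1)) ≤ 1 := by
  have h2 : ∑ j ∈ Finset.range k, α ^ (k - 1) ≤ ∑ j ∈ Finset.range k, α ^ j :=
    Finset.sum_le_sum fun j hj =>
      pow_le_pow_of_le_one h0 h1 (by have := Finset.mem_range.1 hj; omega)
  rw [Finset.sum_const, Finset.card_range, nsmul_eq_mul] at h2
  have h3 := one_sub_mul_geom_sum_le h0 k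
  rw [Fin.sum_univ_eq_sum_range (fun k => α ^ k) k] at h3
  exact (mul_le_mul_of_nonneg_left h2 (sub_nonneg.2 h1)).trans h3

lemma gen_sq_le {n : ℕ} (x : Vec n) {α : ℝ} (h0 : 0 ≤ α) (h1 : α ≤ 1) :
    gen x α ^ 2 ≤ ‖x‖ ^ 2 * (1 - α) := by
  have hs := sub_nonneg.2 h1
  refine (Finset.sum_mul_sq_le_sq_mul_sq _ _ _).trans ?_
  rw [EuclideanSpace.norm_sq_eq]
  simp only [Real.norm_eq_abs, sq_abs]
  refine mul_le_mul_of_nonneg_left ?_ (by positivity)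
  calc ∑ k : Fin n, ((1 - α) * α ^ (k : ℕ)) ^ 2
      ≤ ∑ k : Fin n, (1 - α) * ((1 - α) * α ^ (k : ℕ)) := by
        refine Finset.sum_le_sum fun k _ => ?_
        have h2 : α ^ (k : ℕ) ≤ 1 := pow_le_one₀ h0 h1
        have h3 : 0 ≤ α ^ (k : ℕ) := pow_nonneg h0 _
        have : (1 - α) * ((1 - α) * α ^ (k : ℕ)) * α ^ (k : ℕ) ≤
          (1 - α) * ((1 - α) * α ^ (k : ℕ)) * 1 := by gcongr
        linarith [this, mul_pow (1 - α) (α ^ (k : ℕ)) 2]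
    _ = (1 - α) * ((1 - α) * ∑ k : Fin n, α ^ (k : ℕ)) := by
        rw [← Finset.mul_sum, ← Finset.mul_sum]
    _ ≤ (1 - α) * 1 := mul_le_mul_of_nonneg_left (one_sub_mul_geom_sum_le h0 n) hs
    _ = 1 - α := mul_one _

lemma genDeriv_sq_le {n : ℕ} (x : Vec n) {α : ℝ} (h0 : 0 ≤ α) (h1 : α ≤ 1) :
    genDeriv x α ^ 2 * (1 - α) ≤ 2 * ‖x‖ ^ 2 := by
  have hs := sub_nonneg.2 h1
  have h2 : genDeriv x α ^ 2 ≤ ‖x‖ ^ 2 * ∑ k : Fin n,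
      ((1 - α) * ((k : ℕ) * α ^ ((k : ℕ) - 1)) - α ^ (k : ℕ)) ^ 2 := by
    refine (Finset.sum_mul_sq_le_sq_mul_sq _ _ _).trans ?_
    rw [EuclideanSpace.norm_sq_eq]
    simp only [Real.norm_eq_abs, sq_abs]
    exact le_rfl
  -- Termwise `(a - b)² ≤ a + b` for `a, b ∈ [0, 1]`.
  have h3 : ∑ k : Fin n, ((1 - α) * ((k : ℕ) * α ^ ((k : ℕ) - 1)) - α ^ (k : ℕ)) ^ 2 ≤
      (1 - α) * ∑ k : Fin n, ((k : ℕ) * α ^ ((k : ℕ) - 1)) + ∑ k : Fin n, α ^ (k : ℕ) := by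
    rw [Finset.mul_sum, ← Finset.sum_add_distrib]
    refine Finset.sum_le_sum fun k _ => ?_
    have a1 := mul_pow_pred_mul_one_sub_le h0 h1 (k : ℕ)
    have a2 : 0 ≤ (1 - α) * ((k : ℕ) * α ^ ((k : ℕ) - 1)) := by positivity
    have a3 : α ^ (k : ℕ) ≤ 1 := pow_le_one₀ h0 h1
    have a4 : 0 ≤ α ^ (k : ℕ) := pow_nonneg h0 _
    nlinarith
  have h4 := mul_le_mul_of_nonneg_left h3 hs
  have h5 := one_sub_sq_mul_sum_le h0 h1 n
  have h6 := one_sub_mul_geom_sum_le h0 n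
  calc genDeriv x α ^ 2 * (1 - α) ≤ _ := mul_le_mul_of_nonneg_right h2 hs
    _ = ‖x‖ ^ 2 * ((1 - α) * ∑ k : Fin n,
      ((1 - α) * ((k : ℕ) * α ^ ((k : ℕ) - 1)) - α ^ (k : ℕ)) ^ 2) := by ring
    _ ≤ ‖x‖ ^ 2 * 2 := by
        refine mul_le_mul_of_nonneg_left (h4.trans ?_) (by positivity)
        linarith
    _ = _ := mul_comm _ _

/-- The bound on `genDeriv` blows up like `(1 - s)^(-1/2)` and the bound on `gen` vanishes like `(1
- s)^(1/2)`, so the derivative `2 · gen · genDeriv` of the square is at most `2√2 ≤ 3`. The endpoint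
`1` is excluded in order to divide by `1 - s`. -/
lemma abs_gen_sq_sub_le {n : ℕ} {x : Vec n} (hx : ‖x‖ = 1) {α β : ℝ}
    (hα : α ∈ Set.Ico (0 : ℝ) 1) (hβ : β ∈ Set.Ico (0 : ℝ) 1) :
    |gen x β ^ 2 - gen x α ^ 2| ≤ 3 * |β - α| := by
  have hd : ∀ s ∈ Set.Ico (0 : ℝ) 1, HasDerivWithinAt (fun s => gen x s ^ 2)
      (2 * gen x s * genDeriv x s) (Set.Ico 0 1) s := by
    intro s _
    have := (hasDerivAt_gen x s).fun_pow 2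
    simpa using this.hasDerivWithinAt
  refine (convex_Ico (0 : ℝ) 1).norm_image_sub_le_of_norm_hasDerivWithin_le hd ?_ hα hβ
  intro s hs
  have h1 := gen_sq_le x hs.1 hs.2.le
  have h2 := genDeriv_sq_le x hs.1 hs.2.le
  rw [hx] at h1 h2
  have hs' : 0 < 1 - s := sub_pos.2 hs.2
  refine abs_le_of_sq_le_sq ?_ (by norm_num)
  have h3 : gen x s ^ 2 * genDeriv x s ^ 2 ≤ 1 ^ 2 * (1 - s) * genDeriv x s ^ 2 :=
    mul_le_mul_of_nonneg_right h1 (sq_nonneg _)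
  nlinarith

/-- A unit vector's generating function is bounded by a power of its mean square. -/
lemma gen_pow_four_le {n : ℕ} {x : Vec n} (hx : ‖x‖ = 1) {α : ℝ} (h0 : 0 ≤ α) (h1 : α ≤ 1) :
    gen x α ^ 4 ≤ 12 * ∫ s in (0 : ℝ)..1, gen x s ^ 2 := by
  set F := gen x α ^ 2 with hF
  have hF0 : 0 ≤ F := sq_nonneg _
  have hF1 : F ≤ 1 - α := by
    have := gen_sq_le x h0 h1
    rw [hx] at this
    linarith
  have hint : ∀ a b : ℝ, IntervalIntegrable (fun s => gen x s ^ 2) MeasureTheory.volume a b :=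
    fun a b => ((continuous_gen x).pow 2).intervalIntegrable _ _
  -- Since `F ≤ 1 - α`, the interval `[α, α + F/6]` stays inside `[0, 1]`. The square is
  -- `3`-Lipschitz, hence at least `F - 3 · F/6 = F/2` there, which contributes `F²/12` to the
  -- integral.
  have hb : α + F / 6 ≤ 1 := by linarith
  have h2 : ∫ s in α..(α + F / 6), gen x s ^ 2 ≤ ∫ s in (0 : ℝ)..1, gen x s ^ 2 :=
    intervalIntegral.integral_mono_interval h0 (by linarith) hb
      (Filter.Eventually.of_forall fun s => sq_nonneg _) (hint _ _)
  have h3 : ∫ s in α..(α + F / 6), F / 2 ≤ ∫ s in α..(α + F / 6), gen x s ^ 2 := by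
    refine intervalIntegral.integral_mono_on (by linarith) (by simp) (hint _ _) ?_
    intro s hs
    rcases h1.eq_or_lt with rfl | h1'
    · have : F = 0 := by linarith
      rw [this]; simp; positivity
    · have h4 := abs_gen_sq_sub_le hx (α := α) (β := s) ⟨h0, h1'⟩
        ⟨h0.trans hs.1, by linarith [hs.2]⟩
      rw [abs_of_nonneg (sub_nonneg.2 hs.1)] at h4
      have h5 := (abs_le.1 h4).1
      linarith [hs.2]
  rw [intervalIntegral.integral_const, smul_eq_mul] at h3
  have : gen x α ^ 4 = F ^ 2 := by rw [hF]; ring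
  rw [this]
  nlinarith

/-! ### Exponential decay of the Hankel eigenvalues. -/

lemma abs_pow_sub_taylor_le {a δ : ℝ} (h0 : 0 ≤ a) (h1 : a ≤ 1) (hδ : |δ| ≤ (1 - a) / 2)
    (k J : ℕ) :
    |(a + δ) ^ k - ∑ n ∈ Finset.range J, k.choose n * a ^ (k - n) * δ ^ n| ≤ (1 / 2) ^ J := by
  -- The range is extended by `J` so that it contains the first `J` terms even when `J > k`; the
  -- added binomial coefficients vanish.
  have expand : ∀ e : ℝ, (a + e) ^ k =
      ∑ n ∈ Finset.range (k + 1 + J), k.choose n * a ^ (k - n) * e ^ n := by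
    intro e
    rw [add_comm a e, add_pow]
    refine (Finset.sum_subset (Finset.range_mono (Nat.le_add_right _ _)) ?_).trans
      (Finset.sum_congr rfl fun n _ => by ring)
    intro n _ hn
    rw [Nat.choose_eq_zero_of_lt (by simpa using hn)]
    simp
  rw [expand δ, ← Finset.sum_Ico_eq_sub _ (Nat.le_add_left J (k + 1))]
  have h2 : ∑ n ∈ Finset.range (k + 1 + J), k.choose n * a ^ (k - n) * (1 - a) ^ n = 1 := by
    rw [← expand (1 - a)]; simp
  have hs := sub_nonneg.2 h1
  -- As `|δ| ≤ (1 - a)/2`, the `n`-th term is at most `2⁻ⁿ` times that of `(a + (1 - a))ᵏ = 1`, so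
  -- the tail from `J` on is at most `2⁻ᴶ`.
  calc _ ≤ ∑ n ∈ Finset.Ico J (k + 1 + J), |k.choose n * a ^ (k - n) * δ ^ n| :=
        Finset.abs_sum_le_sum_abs _ _
    _ ≤ ∑ n ∈ Finset.Ico J (k + 1 + J),
          (1 / 2) ^ J * (k.choose n * a ^ (k - n) * (1 - a) ^ n) := by
        refine Finset.sum_le_sum fun n hn => ?_
        have h3 : |δ| ^ n ≤ (1 / 2) ^ J * (1 - a) ^ n := by
          calc |δ| ^ n ≤ ((1 - a) / 2) ^ n := pow_le_pow_left₀ (abs_nonneg _) hδ n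
            _ = (1 / 2) ^ n * (1 - a) ^ n := by rw [← mul_pow]; ring
            _ ≤ _ := mul_le_mul_of_nonneg_right
              (pow_le_pow_of_le_one (by norm_num) (by norm_num) (Finset.mem_Ico.1 hn).1)
              (pow_nonneg hs n)
        rw [abs_mul, abs_pow δ, abs_of_nonneg (by positivity : 0 ≤ (k.choose n : ℝ) * a ^ (k - n))]
        calc _ ≤ (k.choose n : ℝ) * a ^ (k - n) * ((1 / 2) ^ J * (1 - a) ^ n) :=
              mul_le_mul_of_nonneg_left h3 (by positivity)
          _ = _ := by ring
    _ ≤ ∑ n ∈ Finset.range (k + 1 + J),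
          (1 / 2) ^ J * (k.choose n * a ^ (k - n) * (1 - a) ^ n) := by
        refine Finset.sum_le_sum_of_subset_of_nonneg ?_ fun n _ _ => by positivity
        rw [Finset.range_eq_Ico]
        exact Finset.Ico_subset_Ico_left (Nat.zero_le _)
    _ = _ := by rw [← Finset.mul_sum, h2, mul_one]

/-- The centre of the `j`-th dyadic interval `1 - α ∈ [2⁻ʲ⁻¹, 2⁻ʲ]`. -/
def dyadicCentre (j : ℕ) : ℝ := 1 - 3 / 4 * (1 / 2) ^ j

/-- A vector orthogonal to the Taylor polynomials of order `J` at the first `J` dyadic centres has a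
small generating function. -/
lemma abs_gen_le_of_orthogonal {n : ℕ} (x : Vec n) (J : ℕ)
    (hx : ∀ j < J, ∀ r < J,
      ∑ k : Fin n, x k * ((k : ℕ).choose r * dyadicCentre j ^ ((k : ℕ) - r)) = 0)
    {α : ℝ} (h0 : 0 ≤ α) (h1 : α ≤ 1) :
    |gen x α| ≤ (∑ k, |x k|) * (1 / 2) ^ J := by
  have hs := sub_nonneg.2 h1
  -- Very close to `1` the factor `1 - α` is small enough by itself; every other `α` lies in one of
  -- the first `J` dyadic intervals.
  rcases le_or_gt (1 - α) ((1 / 2) ^ J) with h | h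
  · rw [Finset.sum_mul]
    refine (Finset.abs_sum_le_sum_abs _ _).trans (Finset.sum_le_sum fun k _ => ?_)
    rw [abs_mul, abs_of_nonneg (by positivity : 0 ≤ (1 - α) * α ^ (k : ℕ))]
    refine mul_le_mul_of_nonneg_left ?_ (abs_nonneg _)
    have : α ^ (k : ℕ) ≤ 1 := pow_le_one₀ h0 h1
    nlinarith
  · have hpos : 0 < 1 - α := lt_of_le_of_lt (by positivity) h
    obtain ⟨j, hj1, hj2⟩ := exists_nat_pow_near_of_lt_one hpos (by linarith : 1 - α ≤ 1)
      (by norm_num : (0 : ℝ) < 1 / 2) (by norm_num)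
    have hjJ : j < J := by
      by_contra hc
      have := pow_le_pow_of_le_one (by norm_num : (0 : ℝ) ≤ 1 / 2) (by norm_num) (not_lt.1 hc)
      linarith
    have hp : (1 / 2 : ℝ) ^ j ≤ 1 := pow_le_one₀ (by norm_num) (by norm_num)
    have hp0 : (0 : ℝ) < (1 / 2) ^ j := by positivity
    rw [pow_succ] at hj1
    set a := dyadicCentre j with ha
    have ha' : a = 1 - 3 / 4 * (1 / 2) ^ j := rfl
    -- Orthogonality allows the Taylor polynomial at the centre to be subtracted for free. The
    -- half-width `2⁻ʲ/4` is below half the distance `3/4 · 2⁻ʲ` from the centre to `1`, as the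
    -- Taylor estimate requires.
    have e : gen x α = (1 - α) * ∑ k : Fin n, x k * ((a + (α - a)) ^ (k : ℕ) -
        ∑ r ∈ Finset.range J, (k : ℕ).choose r * a ^ ((k : ℕ) - r) * (α - a) ^ r) := by
      have z : ∑ k : Fin n, x k *
          ∑ r ∈ Finset.range J, (k : ℕ).choose r * a ^ ((k : ℕ) - r) * (α - a) ^ r = 0 := by
        simp_rw [Finset.mul_sum]
        rw [Finset.sum_comm]
        refine Finset.sum_eq_zero fun r hr => ?_
        have := hx j hjJ r (Finset.mem_range.1 hr)
        calc _ = (∑ k : Fin n, x k * ((k : ℕ).choose r * a ^ ((k : ℕ) - r))) * (α - a) ^ r := by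
              rw [Finset.sum_mul]
              exact Finset.sum_congr rfl fun k _ => by ring
          _ = 0 := by rw [this, zero_mul]
      simp_rw [mul_sub, Finset.sum_sub_distrib]
      rw [mul_sub, z, mul_zero, sub_zero, gen, Finset.mul_sum]
      refine Finset.sum_congr rfl fun k _ => ?_
      rw [add_sub_cancel]; ring
    rw [e, abs_mul, abs_of_pos hpos]
    have b : |∑ k : Fin n, x k * ((a + (α - a)) ^ (k : ℕ) -
        ∑ r ∈ Finset.range J, (k : ℕ).choose r * a ^ ((k : ℕ) - r) * (α - a) ^ r)| ≤
        (∑ k, |x k|) * (1 / 2) ^ J := by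
      rw [Finset.sum_mul]
      refine (Finset.abs_sum_le_sum_abs _ _).trans (Finset.sum_le_sum fun k _ => ?_)
      rw [abs_mul]
      refine mul_le_mul_of_nonneg_left ?_ (abs_nonneg _)
      refine abs_pow_sub_taylor_le (a := a) (by linarith) (by linarith) ?_ _ _
      rw [abs_le]
      constructor <;> linarith
    exact (mul_le_of_le_one_left (abs_nonneg _) (by linarith)).trans b

lemma sum_abs_le_sqrt_mul_norm {n : ℕ} (x : Vec n) : (∑ k, |x k|) ^ 2 ≤ n * ‖x‖ ^ 2 := by
  rw [EuclideanSpace.norm_sq_eq]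
  have := sq_sum_le_card_mul_sum_sq (s := (Finset.univ : Finset (Fin n))) (f := fun k => |x k|)
  simpa using this

variable {n : ℕ} {σ : Fin n → ℝ} {φ : Fin n → Vec n}

lemma IsFilterBank.eigenvalue_eq (hF : IsFilterBank n σ φ) (i : Fin n) :
    σ i = ∫ α in (0 : ℝ)..1, gen (φ i) α ^ 2 := by
  rw [← inner_hankel, hF.eigen, inner_smul_right, real_inner_self_eq_norm_sq,
    hF.orthonormal.norm_eq_one]
  ring

lemma IsFilterBank.nonneg (hF : IsFilterBank n σ φ) (i : Fin n) : 0 ≤ σ i := by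
  rw [hF.eigenvalue_eq]
  exact intervalIntegral.integral_nonneg (by norm_num) fun _ _ => sq_nonneg _

lemma IsFilterBank.gen_pow_four_le (hF : IsFilterBank n σ φ) (i : Fin n) {α : ℝ} (h0 : 0 ≤ α)
    (h1 : α ≤ 1) : gen (φ i) α ^ 4 ≤ 12 * σ i := by
  rw [hF.eigenvalue_eq]
  exact OSF.gen_pow_four_le (hF.orthonormal.norm_eq_one i) h0 h1

/-- The eigenvalues of the Hankel matrix decay exponentially in the root of their index. -/
lemma IsFilterBank.eigenvalue_le (hF : IsFilterBank n σ φ) (i : Fin n) {J : ℕ}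
    (hJ : J * J ≤ (i : ℕ)) : σ i ≤ n * (1 / 4) ^ J := by
  have hle : (i : ℕ) + 1 ≤ n := i.2
  let comb : (Fin ((i : ℕ) + 1) → ℝ) →ₗ[ℝ] Vec n :=
    ∑ l, (LinearMap.proj l).smulRight (φ (Fin.castLE hle l))
  have comb_apply : ∀ c, comb c = ∑ l, c l • φ (Fin.castLE hle l) := by
    intro c; simp [comb]
  let Λ : (Fin ((i : ℕ) + 1) → ℝ) →ₗ[ℝ] (Fin J × Fin J → ℝ) :=
    { toFun := fun c p => ∑ k : Fin n, comb c k *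
        ((k : ℕ).choose (p.2 : ℕ) * dyadicCentre p.1 ^ ((k : ℕ) - p.2))
      map_add' := by
        intro c d; ext p
        simp [add_mul, Finset.sum_add_distrib]
      map_smul' := by
        intro r c; ext p
        simp [Finset.mul_sum, mul_assoc] }
  -- The span of the first `i + 1` eigenvectors has dimension greater than `J²`, the number of
  -- orthogonality conditions. On that span the quadratic form is at least `σ i ‖x‖²`, while a
  -- vector in the kernel makes it tiny.
  have hker : LinearMap.ker Λ ≠ ⊥ := by
    refine LinearMap.ker_ne_bot_of_finrank_lt ?_
    simp
    omega
  obtain ⟨c, hc, hc0⟩ := Submodule.exists_mem_ne_zero_of_ne_bot hker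
  have horth : Orthonormal ℝ fun l => φ (Fin.castLE hle l) :=
    hF.orthonormal.comp _ (Fin.castLE_injective hle)
  set x := comb c with hx
  have hnorm : ‖x‖ ^ 2 = ∑ l, c l ^ 2 := by
    rw [← real_inner_self_eq_norm_sq, hx, comb_apply, horth.inner_sum]
    simp [sq]
  have hpos : 0 < ‖x‖ ^ 2 := by
    rw [hnorm]
    obtain ⟨l, hl⟩ := Function.ne_iff.1 hc0
    have hl' : c l ≠ 0 := hl
    exact Finset.sum_pos' (fun l _ => sq_nonneg _) ⟨l, Finset.mem_univ _, by positivity⟩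
  have hquad : ∫ α in (0 : ℝ)..1, gen x α ^ 2 = ∑ l, σ (Fin.castLE hle l) * c l ^ 2 := by
    rw [← inner_hankel]
    have : mulV (hankel n) x = ∑ l, (σ (Fin.castLE hle l) * c l) • φ (Fin.castLE hle l) := by
      rw [hx, comb_apply, mulV_sum]
      refine Finset.sum_congr rfl fun l _ => ?_
      rw [mulV_smul, hF.eigen, smul_smul, mul_comm]
    rw [this, hx, comb_apply, horth.inner_sum]
    refine Finset.sum_congr rfl fun l _ => ?_
    simp; ring
  have hlower : σ i * ‖x‖ ^ 2 ≤ ∫ α in (0 : ℝ)..1, gen x α ^ 2 := by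
    rw [hquad, hnorm, Finset.mul_sum]
    refine Finset.sum_le_sum fun l _ => mul_le_mul_of_nonneg_right ?_ (sq_nonneg _)
    refine hF.decreasing ?_
    rw [Fin.le_def]
    simpa using Nat.lt_succ_iff.1 l.2
  have hsmall : ∀ α ∈ Set.Icc (0 : ℝ) 1, gen x α ^ 2 ≤ n * ‖x‖ ^ 2 * (1 / 4) ^ J := by
    intro α hα
    have h1 := abs_gen_le_of_orthogonal x J
      (fun j hj r hr => congrFun (LinearMap.mem_ker.1 hc) (⟨j, hj⟩, ⟨r, hr⟩)) hα.1 hα.2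
    calc gen x α ^ 2 = |gen x α| ^ 2 := (sq_abs _).symm
      _ ≤ ((∑ k, |x k|) * (1 / 2) ^ J) ^ 2 := pow_le_pow_left₀ (abs_nonneg _) h1 2
      _ = (∑ k, |x k|) ^ 2 * (1 / 4) ^ J := by
          rw [mul_pow, ← pow_mul, mul_comm J 2, pow_mul]; norm_num
      _ ≤ _ := mul_le_mul_of_nonneg_right (sum_abs_le_sqrt_mul_norm x) (by positivity)
  have hupper : ∫ α in (0 : ℝ)..1, gen x α ^ 2 ≤ n * ‖x‖ ^ 2 * (1 / 4) ^ J := by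
    have := intervalIntegral.integral_mono_on (μ := MeasureTheory.volume) (zero_le_one' ℝ)
      (((continuous_gen x).pow 2).intervalIntegrable _ _) intervalIntegrable_const hsmall
    simpa using this
  refine le_of_mul_le_mul_right ?_ hpos
  calc _ ≤ _ := hlower.trans hupper
    _ = _ := by ring

/-! ### The `ℓ¹` norm of the Hankel eigenvectors. -/

lemma hankel_entry_sq_le {n : ℕ} (k j : Fin n) :
    hankel n k j ^ 2 ≤ 4 / ((k : ℕ) + 1 : ℝ) ^ 4 *
      (1 / ((k : ℕ) + 1 + (j : ℕ) : ℝ) - 1 / ((k : ℕ) + 1 + ((j : ℕ) + 1 : ℕ) : ℝ)) := by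
  have hK : (1 : ℝ) ≤ ((k : ℕ) : ℝ) + 1 := by simp
  have hJ : (0 : ℝ) ≤ ((j : ℕ) : ℝ) := by positivity
  simp only [hankel, Matrix.of_apply]
  push_cast
  generalize ((k : ℕ) : ℝ) + 1 = K at *
  generalize ((j : ℕ) : ℝ) = a at *
  have h1 : 0 < K + a := by linarith
  have e1 : (K + (a + 1)) ^ 3 - (K + (a + 1)) = (K + a) * (K + (a + 1)) * (K + a + 2) := by ring
  have e2 : 1 / (K + a) - 1 / (K + (a + 1)) = 1 / ((K + a) * (K + (a + 1))) := by
    field_simp; ring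
  rw [e1, e2, div_pow, div_mul_div_comm]
  -- Keeping one copy of `(K + a)(K + a + 1)` in the denominator makes the bound telescope in `j`.
  have h2 : K ^ 4 ≤ (K + a) * (K + (a + 1)) * (K + a + 2) ^ 2 := by
    calc K ^ 4 = K * K * K ^ 2 := by ring
      _ ≤ (K + a) * (K + (a + 1)) * (K + a + 2) ^ 2 := by
        gcongr <;> linarith
  rw [div_le_div_iff₀ (by positivity) (by positivity)]
  calc 2 ^ 2 * (K ^ 4 * ((K + a) * (K + (a + 1))))
      ≤ 2 ^ 2 * (((K + a) * (K + (a + 1)) * (K + a + 2) ^ 2) * ((K + a) * (K + (a + 1)))) := by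
        gcongr
    _ = _ := by ring

/-- Cauchy–Schwarz on a row whose squared norm is at most `4/(k+1)⁵`. For an eigenvector it says
that the mass sits, up to logarithms, at indices of order at most `σ^(-1/2)`. -/
lemma mulV_hankel_sq_le {n : ℕ} (x : Vec n) (k : Fin n) :
    ((k : ℕ) + 1 : ℝ) ^ 4 * mulV (hankel n) x k ^ 2 ≤ 4 / ((k : ℕ) + 1 : ℝ) * ‖x‖ ^ 2 := by
  have h1 : mulV (hankel n) x k ^ 2 ≤ (∑ j, hankel n k j ^ 2) * ‖x‖ ^ 2 := by
    rw [EuclideanSpace.norm_sq_eq]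
    have := Finset.sum_mul_sq_le_sq_mul_sq Finset.univ (fun j => hankel n k j) (fun j => x j)
    simpa [mulV, Matrix.mulVec, dotProduct] using this
  have h2 : ∑ j, hankel n k j ^ 2 ≤ 4 / ((k : ℕ) + 1 : ℝ) ^ 4 * (1 / ((k : ℕ) + 1 : ℝ)) := by
    refine (Finset.sum_le_sum fun j _ => hankel_entry_sq_le k j).trans ?_
    rw [← Finset.mul_sum]
    refine mul_le_mul_of_nonneg_left ?_ (by positivity)
    rw [Fin.sum_univ_eq_sum_range (fun j : ℕ => 1 / ((k : ℕ) + 1 + (j : ℕ) : ℝ) -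
      1 / ((k : ℕ) + 1 + ((j : ℕ) + 1 : ℕ) : ℝ)) n,
      Finset.sum_range_sub' (fun j : ℕ => 1 / ((k : ℕ) + 1 + (j : ℕ) : ℝ)) n]
    simp
    positivity
  calc _ ≤ ((k : ℕ) + 1 : ℝ) ^ 4 *
        ((4 / ((k : ℕ) + 1 : ℝ) ^ 4 * (1 / ((k : ℕ) + 1 : ℝ))) * ‖x‖ ^ 2) := by
        gcongr
        exact h1.trans (mul_le_mul_of_nonneg_right h2 (sq_nonneg _))
    _ = _ := by field_simp

lemma sum_one_div_le (n : ℕ) : ∑ k : Fin n, 1 / ((k : ℕ) + 1 : ℝ) ≤ 1 + Real.log n := by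
  have h := harmonic_le_one_add_log n
  rw [harmonic] at h
  push_cast at h
  rw [Fin.sum_univ_eq_sum_range (fun k : ℕ => 1 / ((k : ℕ) + 1 : ℝ)) n]
  simpa using h

/-- The `ℓ¹` norm of an eigenvector is at most of order `σ^(-1/4) log n`. -/
lemma IsFilterBank.sqrt_mul_sum_abs_sq_le (hF : IsFilterBank n σ φ) (i : Fin n) :
    √(σ i) * (∑ k, |φ i k|) ^ 2 ≤ 5 * (1 + Real.log n) ^ 2 := by
  set Hn := ∑ k : Fin n, 1 / ((k : ℕ) + 1 : ℝ) with hHn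
  have hn : 1 ≤ n := Nat.one_le_of_lt i.2
  have hH1 : 0 ≤ Hn := by positivity
  have hlog : 0 ≤ Real.log n := Real.log_natCast_nonneg n
  have hφ := hF.orthonormal.norm_eq_one i
  have hsum1 : ∑ k, φ i k ^ 2 = 1 := by
    have := EuclideanSpace.norm_sq_eq (φ i)
    rw [hφ] at this
    simpa using this.symm
  have h4 : σ i ^ 2 * ∑ k : Fin n, ((k : ℕ) + 1 : ℝ) ^ 4 * φ i k ^ 2 ≤ 4 * Hn := by
    rw [Finset.mul_sum, Finset.mul_sum]
    refine Finset.sum_le_sum fun k _ => ?_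
    have := mulV_hankel_sq_le (φ i) k
    rw [hF.eigen, hφ] at this
    simp only [PiLp.smul_apply, smul_eq_mul] at this
    calc _ = ((k : ℕ) + 1 : ℝ) ^ 4 * (σ i * φ i k) ^ 2 := by ring
      _ ≤ _ := this
      _ = _ := by ring
  have h1 : √(σ i) * ∑ k : Fin n, ((k : ℕ) + 1 : ℝ) * φ i k ^ 2 ≤ 1 + 4 * Hn := by
    calc _ = ∑ k : Fin n, (√(σ i) * ((k : ℕ) + 1 : ℝ)) * φ i k ^ 2 := by
          rw [Finset.mul_sum]; exact Finset.sum_congr rfl fun k _ => by ring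
      _ ≤ ∑ k : Fin n, (φ i k ^ 2 + σ i ^ 2 * (((k : ℕ) + 1 : ℝ) ^ 4 * φ i k ^ 2)) := by
          refine Finset.sum_le_sum fun k _ => ?_
          have e : σ i ^ 2 * ((k : ℕ) + 1 : ℝ) ^ 4 = (√(σ i) * ((k : ℕ) + 1 : ℝ)) ^ 4 := by
            rw [mul_pow]
            congr 1
            calc σ i ^ 2 = (√(σ i) ^ 2) ^ 2 := by rw [Real.sq_sqrt (hF.nonneg i)]
              _ = _ := by ring
          -- Interpolation by `y ≤ 1 + y⁴`: the first moment is controlled by the norm and the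
          -- fourth moment `h4`.
          have e2 : √(σ i) * ((k : ℕ) + 1 : ℝ) ≤ 1 + (√(σ i) * ((k : ℕ) + 1 : ℝ)) ^ 4 := by
            generalize √(σ i) * ((k : ℕ) + 1 : ℝ) = y
            nlinarith [sq_nonneg (y ^ 2 - 1 / 2), sq_nonneg (y - 1 / 2)]
          rw [← mul_assoc, e]
          nlinarith [sq_nonneg (φ i k)]
      _ ≤ _ := by
          rw [Finset.sum_add_distrib, hsum1, ← Finset.mul_sum]
          linarith
  -- Cauchy–Schwarz with weights `k + 1`, whose reciprocals sum to `Hn`.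
  have hCS : (∑ k, |φ i k|) ^ 2 ≤ Hn * ∑ k : Fin n, ((k : ℕ) + 1 : ℝ) * φ i k ^ 2 := by
    refine Finset.sum_sq_le_sum_mul_sum_of_sq_le_mul _ (fun k _ => by positivity)
      (fun k _ => by positivity) fun k _ => ?_
    rw [sq_abs]
    refine le_of_eq ?_
    field_simp
  calc √(σ i) * (∑ k, |φ i k|) ^ 2 ≤
        √(σ i) * (Hn * ∑ k : Fin n, ((k : ℕ) + 1 : ℝ) * φ i k ^ 2) := by gcongr
    _ = Hn * (√(σ i) * ∑ k : Fin n, ((k : ℕ) + 1 : ℝ) * φ i k ^ 2) := by ring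
    _ ≤ Hn * (1 + 4 * Hn) := by gcongr
    _ ≤ (1 + Real.log n) * (1 + 4 * (1 + Real.log n)) := by
        have := sum_one_div_le n
        gcongr
    _ ≤ _ := by nlinarith

/-! ### Projected online subgradient descent -/

section OnlineDescent

variable {E : Type*} [NormedAddCommGroup E]

lemma norm_projBall_le [NormedSpace ℝ E] {r : ℝ} (hr : 0 ≤ r) (x : E) : ‖projBall r x‖ ≤ r := by
  unfold projBall
  split_ifs with h
  · exact h
  · have hx : 0 < ‖x‖ := hr.trans_lt (not_le.1 h)
    rw [norm_smul, Real.norm_of_nonneg (by positivity), div_mul_cancel₀ _ hx.ne']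

variable [InnerProductSpace ℝ E]

lemma norm_projBall_sub_le {r : ℝ} (x : E) {θ : E} (hθ : ‖θ‖ ≤ r) :
    ‖projBall r x - θ‖ ≤ ‖x - θ‖ := by
  unfold projBall
  split_ifs with h
  · exact le_rfl
  · have hr : 0 ≤ r := (norm_nonneg _).trans hθ
    have hx : 0 < ‖x‖ := hr.trans_lt (not_le.1 h)
    set c := r / ‖x‖ with hc
    have hc0 : 0 ≤ c := by positivity
    have hc1 : c ≤ 1 := (div_le_one hx).2 (not_le.1 h).le
    have hr' : r = c * ‖x‖ := by rw [hc, div_mul_cancel₀ _ hx.ne']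
    have hin : inner ℝ x θ ≤ ‖x‖ * (c * ‖x‖) :=
      (real_inner_le_norm x θ).trans (by rw [← hr']; gcongr)
    refine le_of_sq_le_sq ?_ (norm_nonneg _)
    rw [norm_sub_sq_real, norm_sub_sq_real, norm_smul, inner_smul_left, Real.norm_of_nonneg hc0]
    simp only [conj_trivial]
    have h1 := mul_le_mul_of_nonneg_left hin (sub_nonneg.2 hc1)
    nlinarith [mul_nonneg (sub_nonneg.2 hc1) (mul_nonneg (sub_nonneg.2 hc1) (sq_nonneg ‖x‖))]

/-- Testing the subgradient inequality at `x + g` gives `‖g‖² ≤ G ‖g‖`. -/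
lemma IsSubgradient.norm_le {f : E → ℝ} {x g : E} (hg : IsSubgradient f x g) {G : ℝ}
    (hG : 0 ≤ G) (hf : ∀ x y, f x - f y ≤ G * ‖x - y‖) : ‖g‖ ≤ G := by
  have h1 := hg (x + g)
  have h2 := hf (x + g) x
  rw [add_sub_cancel_left] at h1 h2
  rw [real_inner_self_eq_norm_sq] at h1
  rcases (norm_nonneg g).eq_or_lt with h | h
  · rwa [← h]
  · nlinarith

lemma subgradient_step {f : E → ℝ} {x g θ : E} {η G D : ℝ} (hg : IsSubgradient f x g)
    (hη : 0 < η) (hG : ‖g‖ ≤ G) (hθ : ‖θ‖ ≤ D) :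
    f x - f θ ≤ (‖x - θ‖ ^ 2 - ‖projBall D (x - η • g) - θ‖ ^ 2) / (2 * η) + G ^ 2 / 2 * η := by
  have h1 := hg θ
  have h2 := pow_le_pow_left₀ (norm_nonneg _) (norm_projBall_sub_le (x - η • g) hθ) 2
  have h3 : x - η • g - θ = (x - θ) - η • g := by abel
  rw [h3, norm_sub_sq_real (x - θ), norm_smul, inner_smul_right, Real.norm_of_nonneg hη.le,
    real_inner_comm] at h2
  have h4 : inner ℝ g (θ - x) = - inner ℝ g (x - θ) := by rw [← inner_neg_right, neg_sub]
  have h5 : ‖g‖ ^ 2 ≤ G ^ 2 := pow_le_pow_left₀ (norm_nonneg _) hG 2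
  have h6 : inner ℝ g (x - θ) ≤
      (‖x - θ‖ ^ 2 - ‖projBall D (x - η • g) - θ‖ ^ 2) / (2 * η) + G ^ 2 / 2 * η := by
    rw [div_add' _ _ _ (by positivity), le_div_iff₀ (by positivity)]
    nlinarith [mul_le_mul_of_nonneg_left h5 (sq_nonneg η)]
  linarith

/-- Regret of projected online subgradient descent over the times `a, …, T`. -/
lemma online_descent_regret {f : ℕ → E → ℝ} {w : ℕ → E} {η : ℕ → ℝ} {D G : ℝ} {a T : ℕ}
    (haT : a ≤ T) (hf : ∀ t ∈ Set.Icc a T, ∀ x y, f t x - f t y ≤ G * ‖x - y‖)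
    (hη : ∀ t ∈ Set.Icc a T, 0 < η t) (hanti : AntitoneOn η (Set.Icc a T))
    (hw : ∀ t ∈ Set.Icc a T, ‖w t‖ ≤ D)
    (hstep : ∀ t, a ≤ t → t < T → ∃ g, IsSubgradient (f t) (w t) g ∧
      w (t + 1) = projBall D (w t - η t • g))
    {θ : E} (hθ : ‖θ‖ ≤ D) (hG : 0 ≤ G) :
    ∑ t ∈ Finset.Icc a T, (f t (w t) - f t θ) ≤
      2 * D ^ 2 / η T + G ^ 2 / 2 * ∑ t ∈ Finset.Icc a T, η t := by
  have hdist : ∀ t ∈ Set.Icc a T, ‖w t - θ‖ ^ 2 ≤ (2 * D) ^ 2 := fun t ht =>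
    pow_le_pow_left₀ (norm_nonneg _)
      ((norm_sub_le _ _).trans (by linarith [hw t ht])) 2
  -- The potential `((2D)² - ‖w t - θ‖²)/(2 η t)` has a nonnegative numerator, so replacing `η t` by
  -- the smaller `η (t+1)` only increases it.
  have main : ∀ t, a ≤ t → t ≤ T →
      ∑ s ∈ Finset.Ico a t, (f s (w s) - f s θ) ≤
        ((2 * D) ^ 2 - ‖w t - θ‖ ^ 2) / (2 * η t) + G ^ 2 / 2 * ∑ s ∈ Finset.Ico a t, η s := by
    intro t hat
    induction t, hat using Nat.le_induction with
    | base =>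
      intro _
      have h1 := hdist a ⟨le_rfl, haT⟩
      have h2 := hη a ⟨le_rfl, haT⟩
      simp only [Finset.Ico_self, Finset.sum_empty, mul_zero, add_zero]
      exact div_nonneg (by linarith) (by linarith)
    | succ t hat ih =>
      intro htT
      have ih := ih (by omega)
      obtain ⟨g, hg, hwt⟩ := hstep t hat (by omega)
      have hgG := hg.norm_le hG (hf t ⟨hat, by omega⟩)
      have hs := subgradient_step hg (hη t ⟨hat, by omega⟩) hgG hθ
      rw [← hwt] at hs
      rw [Finset.sum_Ico_succ_top hat, Finset.sum_Ico_succ_top hat, mul_add]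
      have hpos := hη (t + 1) ⟨by omega, htT⟩
      have h3 : ((2 * D) ^ 2 - ‖w (t + 1) - θ‖ ^ 2) / (2 * η t) ≤
          ((2 * D) ^ 2 - ‖w (t + 1) - θ‖ ^ 2) / (2 * η (t + 1)) := by
        refine div_le_div_of_nonneg_left ?_ (by positivity) ?_
        · linarith [hdist (t + 1) ⟨by omega, htT⟩]
        · linarith [hanti ⟨hat, by omega⟩ ⟨by omega, htT⟩ (Nat.le_succ t)]
      have h4 : ((2 * D) ^ 2 - ‖w t - θ‖ ^ 2) / (2 * η t) +
          (‖w t - θ‖ ^ 2 - ‖w (t + 1) - θ‖ ^ 2) / (2 * η t) =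
          ((2 * D) ^ 2 - ‖w (t + 1) - θ‖ ^ 2) / (2 * η t) := by
        rw [← add_div]; congr 1; ring
      linarith
  have hT := hη T ⟨haT, le_rfl⟩
  have hlast := hf T ⟨haT, le_rfl⟩ (w T) θ
  have h1 := main T haT le_rfl
  rw [← Finset.Ico_succ_right_eq_Icc, Nat.succ_eq_succ, Nat.succ_eq_add_one,
    Finset.sum_Ico_succ_top haT, Finset.sum_Ico_succ_top haT, mul_add]
  -- There is no update after time `T`. The last loss is handled by Lipschitz continuity and the
  -- arithmetic-geometric mean inequality, and its square term cancels the one left in the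
  -- potential.
  have h2 : G * ‖w T - θ‖ ≤ ‖w T - θ‖ ^ 2 / (2 * η T) + G ^ 2 / 2 * η T := by
    rw [div_add' _ _ _ (by positivity), le_div_iff₀ (by positivity)]
    nlinarith [sq_nonneg (‖w T - θ‖ - G * η T)]
  have h3 : ((2 * D) ^ 2 - ‖w T - θ‖ ^ 2) / (2 * η T) + ‖w T - θ‖ ^ 2 / (2 * η T) =
      2 * D ^ 2 / η T := by
    rw [← add_div]; field_simp; ring
  linarith

end OnlineDescent

lemma sum_one_div_sqrt_le (T : ℕ) : ∑ t ∈ Finset.Icc 1 T, 1 / √(t : ℝ) ≤ 2 * √(T : ℝ) := by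
  induction T with
  | zero => simp
  | succ T ih =>
    rw [Finset.sum_Icc_succ_top (by omega)]
    have h1 : 0 < √((T + 1 : ℕ) : ℝ) := Real.sqrt_pos.2 (by positivity)
    have h2 : √(T : ℝ) ^ 2 = T := Real.sq_sqrt (by positivity)
    have h3 : √((T + 1 : ℕ) : ℝ) ^ 2 = T + 1 := by
      rw [Real.sq_sqrt (by positivity)]; push_cast; ring
    have h4 : 1 / √((T + 1 : ℕ) : ℝ) ≤ 2 * √((T + 1 : ℕ) : ℝ) - 2 * √(T : ℝ) := by
      rw [div_le_iff₀ h1]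
      nlinarith [sq_nonneg (√((T + 1 : ℕ) : ℝ) - √(T : ℝ))]
    linarith

/-! ### The learned predictor as a linear function of its weights -/

lemma norm_lag_le {d : ℕ} {v : ℕ → Vec d} {R : ℝ} {t : ℕ} (hR : 0 ≤ R)
    (hv : ∀ s ≤ t, ‖v s‖ ≤ R) (k : ℕ) : ‖lag v t k‖ ≤ R := by
  unfold lag
  split_ifs
  · exact hv _ (Nat.sub_le _ _)
  · simpa using hR

lemma norm_filtered_le {n d : ℕ} (ψ : Vec n) {v : ℕ → Vec d} {R : ℝ} {t : ℕ} (hR : 0 ≤ R)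
    (hv : ∀ s ≤ t, ‖v s‖ ≤ R) (a : ℕ) : ‖filtered ψ v t a‖ ≤ (∑ k, |ψ k|) * R := by
  unfold filtered
  rw [Finset.sum_mul]
  refine (norm_sum_le _ _).trans (Finset.sum_le_sum fun k _ => ?_)
  rw [norm_smul, Real.norm_eq_abs]
  exact mul_le_mul_of_nonneg_left (norm_lag_le hR hv _) (abs_nonneg _)

section Predictor

variable {T h m din dout : ℕ}

/-- The matrix of the learned weights with a given index. -/
def block (w : Learned T h m din dout) (c : Fin (m - 1) ⊕ Fin (numFilters T h)) :
    Matrix (Fin dout) (Fin din) ℝ :=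
  Matrix.of fun a b => w (c, a, b)

/-- The vectors that the learned matrices multiply at time `t`. -/
def feature (σ : Fin (T - 1) → ℝ) (φ : Fin (T - 1) → Vec (T - 1)) (u : ℕ → Vec din) (t : ℕ) :
    Fin (m - 1) ⊕ Fin (numFilters T h) → Vec din :=
  Sum.elim (fun j => lag u t (j + 1)) fun i => (σ (i.castLE (min_le_right _ _))) ^ (1 / 4 : ℝ) •
    filtered (φ (i.castLE (min_le_right _ _))) u t 2

/-- The part of the prediction that depends on the learned weights. -/
def learnedPart (σ : Fin (T - 1) → ℝ) (φ : Fin (T - 1) → Vec (T - 1)) (u : ℕ → Vec din) (t : ℕ)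
    (w : Learned T h m din dout) : Vec dout :=
  ∑ c, mulV (block w c) (feature σ φ u t c)

variable (σ : Fin (T - 1) → ℝ) (φ : Fin (T - 1) → Vec (T - 1)) (u : ℕ → Vec din)
  (y : ℕ → Vec dout)

lemma rawPrediction_eq (hm : 1 ≤ m) (w : Learned T h m din dout) (t : ℕ) :
    rawPrediction σ φ u y w.weights t = learnedPart σ φ u t w + lag y t 1 := by
  have hP : ∑ j, mulV (w.weights.P j) (lag y t (j + 1)) = lag y t 1 := by
    obtain ⟨m, rfl⟩ : ∃ k, m = k + 1 := ⟨m - 1, by omega⟩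
    rw [Fin.sum_univ_succ]
    simp [Learned.weights, one_mulV, zero_mulV]
  unfold rawPrediction learnedPart
  rw [hP, Fintype.sum_sum_type]
  simp only [feature, Sum.elim_inl, Sum.elim_inr, mulV_smul]
  have hN : ∑ i, (σ (i.castLE (min_le_right _ _))) ^ (1 / 4 : ℝ) •
      mulV (w.weights.N i) (filtered (φ (i.castLE (min_le_right _ _))) y t 1) = 0 := by
    simp [Learned.weights, zero_mulV]
  rw [hN, add_zero]
  rfl

lemma norm_sq_eq_sum_frob (w : Learned T h m din dout) :
    ‖w‖ ^ 2 = ∑ c, frob (block w c) ^ 2 := by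
  rw [EuclideanSpace.norm_sq_eq, Fintype.sum_prod_type]
  refine Finset.sum_congr rfl fun c _ => ?_
  rw [frob_sq, Fintype.sum_prod_type]
  simp [block]

lemma norm_learnedPart_sub_le (w w' : Learned T h m din dout) (t : ℕ) {G : ℝ} (hG0 : 0 ≤ G)
    (hG : ∑ c, ‖(feature (m := m) (h := h) σ φ u t c : Vec din)‖ ^ 2 ≤ G ^ 2) :
    ‖learnedPart σ φ u t w - learnedPart σ φ u t w'‖ ≤ G * ‖w - w'‖ := by
  have h1 : learnedPart σ φ u t w - learnedPart σ φ u t w' =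
      ∑ c, mulV (block (w - w') c) (feature σ φ u t c) := by
    unfold learnedPart
    rw [← Finset.sum_sub_distrib]
    refine Finset.sum_congr rfl fun c _ => ?_
    rw [← sub_mulV]
    rfl
  rw [h1]
  have h2 : ‖∑ c, mulV (block (w - w') c) (feature σ φ u t c)‖ ≤
      ∑ c, frob (block (w - w') c) * ‖(feature σ φ u t c : Vec din)‖ :=
    (norm_sum_le _ _).trans (Finset.sum_le_sum fun c _ => norm_mulV_le _ _)
  refine h2.trans (abs_le_of_sq_le_sq' ?_ (by positivity)).2
  refine (Finset.sum_mul_sq_le_sq_mul_sq _ _ _).trans ?_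
  rw [← norm_sq_eq_sum_frob, mul_pow, mul_comm]
  exact mul_le_mul_of_nonneg_right hG (sq_nonneg _)

lemma loss_sub_le (hm : 1 ≤ m) (w w' : Learned T h m din dout) (t : ℕ) {G : ℝ} (hG0 : 0 ≤ G)
    (hG : ∑ c, ‖(feature (m := m) (h := h) σ φ u t c : Vec din)‖ ^ 2 ≤ G ^ 2) :
    loss σ φ u y t w - loss σ φ u y t w' ≤ G * ‖w - w'‖ := by
  refine le_trans ?_ (norm_learnedPart_sub_le σ φ u w w' t hG0 hG)
  unfold loss
  refine (norm_sub_norm_le _ _).trans (le_of_eq ?_)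
  rw [rawPrediction_eq σ φ u y hm, rawPrediction_eq σ φ u y hm]
  congr 1
  abel

variable {σ φ}

/-- Bounds the squared Lipschitz constant of the losses. The scaling `σ^(1/4)` is balanced: it tames
the `ℓ¹` norm of the filter up to a logarithm, and it still dominates the coefficients that the
comparator has to divide by it. -/
lemma sum_norm_feature_sq_le (hF : IsFilterBank (T - 1) σ φ) {R : ℝ} (hR : 0 ≤ R) {t : ℕ}
    (hu : ∀ s ≤ t, ‖u s‖ ≤ R) :
    ∑ c, ‖(feature (m := m) (h := h) σ φ u t c : Vec din)‖ ^ 2 ≤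
      R ^ 2 * (m + h * (5 * (1 + Real.log T) ^ 2)) := by
  rw [Fintype.sum_sum_type]
  have h1 : ∑ j : Fin (m - 1), ‖(feature (h := h) σ φ u t (Sum.inl j) : Vec din)‖ ^ 2 ≤
      R ^ 2 * m := by
    calc _ ≤ ∑ j : Fin (m - 1), R ^ 2 :=
          Finset.sum_le_sum fun j _ => pow_le_pow_left₀ (norm_nonneg _) (norm_lag_le hR hu _) 2
      _ ≤ _ := by
          rw [Finset.sum_const, Finset.card_univ, Fintype.card_fin, nsmul_eq_mul, mul_comm]
          gcongr
          exact Nat.sub_le _ _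
  have h2 : ∑ i : Fin (numFilters T h),
      ‖(feature (m := m) σ φ u t (Sum.inr i) : Vec din)‖ ^ 2 ≤
      R ^ 2 * (h * (5 * (1 + Real.log T) ^ 2)) := by
    calc _ ≤ ∑ i : Fin (numFilters T h), R ^ 2 * (5 * (1 + Real.log T) ^ 2) := by
          refine Finset.sum_le_sum fun i _ => ?_
          have hn : 1 ≤ T - 1 := by
            have := (lt_min_iff.1 i.2).2
            omega
          simp only [feature, Sum.elim_inr]
          generalize i.castLE (min_le_right _ _) = l
          have hσ : (σ l ^ (1 / 4 : ℝ)) ^ 2 = √(σ l) := by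
            rw [← Real.rpow_natCast, ← Real.rpow_mul (hF.nonneg l), Real.sqrt_eq_rpow]
            norm_num
          have h4 : Real.log ((T - 1 : ℕ) : ℝ) ≤ Real.log T :=
            Real.log_le_log (by exact_mod_cast hn) (by exact_mod_cast Nat.sub_le _ _)
          have h5 := Real.log_natCast_nonneg (T - 1)
          rw [norm_smul, mul_pow, Real.norm_eq_abs, sq_abs, hσ]
          calc _ ≤ √(σ l) * ((∑ k, |φ l k|) * R) ^ 2 := by
                gcongr
                exact norm_filtered_le _ hR hu _
            _ = R ^ 2 * (√(σ l) * (∑ k, |φ l k|) ^ 2) := by ring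
            _ ≤ R ^ 2 * (5 * (1 + Real.log ((T - 1 : ℕ) : ℝ)) ^ 2) := by
                exact mul_le_mul_of_nonneg_left (hF.sqrt_mul_sum_abs_sq_le l) (sq_nonneg R)
            _ ≤ _ := by gcongr
      _ ≤ _ := by
          rw [Finset.sum_const, Finset.card_univ, Fintype.card_fin, nsmul_eq_mul]
          have : ((numFilters T h : ℕ) : ℝ) ≤ h := by exact_mod_cast min_le_left _ _
          calc _ ≤ (h : ℝ) * (R ^ 2 * (5 * (1 + Real.log T) ^ 2)) := by gcongr
            _ = _ := by ring
  linarith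

/-- `y t` lies in the ball, so projecting the prediction to it cannot increase the distance. -/
lemma norm_prediction_sub_le {R : ℝ} {t : ℕ} (hy : ‖y t‖ ≤ R) (w : ℕ → Learned T h m din dout) :
    ‖prediction σ φ u y R w t - y t‖ ≤ loss σ φ u y t (w t) :=
  norm_projBall_sub_le _ hy

end Predictor

/-! ### Increments of a linear dynamical system -/

/-- In the inductive step, `A B u_s - B u_s` becomes the new term `k = 0` of the convolution. The
kernel `Aᵏ⁺¹ - Aᵏ` is blind to the eigenvalue `1`. -/
lemma LDS.state_succ_sub {din dout : ℕ} (S : LDS din dout) (u : ℕ → Vec din) (s : ℕ) :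
    S.state u (s + 1) - S.state u s =
      (mulV (S.A ^ (s + 1)) S.x₀ - mulV (S.A ^ s) S.x₀) + mulV S.B (u s) +
      ∑ k ∈ Finset.range s, (mulV (S.A ^ (k + 1) * S.B) (u (s - 1 - k)) -
        mulV (S.A ^ k * S.B) (u (s - 1 - k))) := by
  induction s with
  | zero =>
    simp only [LDS.state, zero_add, pow_one, pow_zero, one_mulV, Finset.range_zero,
      Finset.sum_empty, add_zero]
    abel
  | succ s ih =>
    have h1 : S.state u (s + 1 + 1) - S.state u (s + 1) =
        mulV S.A (S.state u (s + 1) - S.state u s) + mulV S.B (u (s + 1)) - mulV S.B (u s) := by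
      rw [mulV_sub]
      simp only [LDS.state]
      abel
    rw [h1, ih, Finset.sum_range_succ']
    simp only [mulV_add, mulV_sub, mulV_sum, ← mul_mulV, ← Matrix.mul_assoc, ← pow_succ']
    have h2 : ∀ k, s - 1 - k = s - (k + 1) := fun k => by omega
    simp only [Nat.add_sub_cancel, h2, zero_add, pow_one, pow_zero, Matrix.one_mul, Nat.sub_zero]
    abel

/-- A vector as a matrix with one column. -/
def colMat {d : ℕ} (x : Vec d) : Matrix (Fin d) (Fin 1) ℝ := Matrix.of fun i _ => x i

/-- The vector `1` of the line. -/
def unitVec : Vec 1 := WithLp.toLp 2 fun _ => 1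

/-- Treats `x₀` as an input matrix with one column, so that `frob_transfer_le` bounds the transient
as well. -/
lemma mulV_colMat {d : ℕ} (x : Vec d) : mulV (colMat x) unitVec = x := by
  ext i
  simp [mulV, colMat, unitVec, Matrix.mulVec, dotProduct]

lemma frob_colMat {d : ℕ} (x : Vec d) : frob (colMat x) = ‖x‖ := by
  rw [EuclideanSpace.norm_eq]
  simp [frob, colMat]

lemma norm_unitVec : ‖unitVec‖ = 1 := by
  simp [unitVec, EuclideanSpace.norm_eq]

/-- The convolution is extended from `s` to `n` terms at no cost, since lags with a negative index
are zero; this matches it to the length of the filters. -/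
lemma LDS.output_succ_sub {din dout : ℕ} (S : LDS din dout) (u : ℕ → Vec din)
    {H : Matrix (Fin S.dim) (Fin S.dim) ℂ} {D : Fin S.dim → ℂ} (hH : IsUnit H.det)
    (hA : S.A.map Complex.ofReal = H * Matrix.diagonal D * H⁻¹) {s n : ℕ} (hs : s ≤ n) :
    S.output u (s + 1) - S.output u s =
      mulV (transfer S.C H (colMat S.x₀) fun l => D l ^ s * (D l - 1)) unitVec +
      mulV (transfer S.C H S.B fun _ => 1) (u s) +
      ∑ k ∈ Finset.range n, mulV (transfer S.C H S.B fun l => D l ^ k * (D l - 1))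
        (lag u (s + 1) (2 + k)) := by
  have h1 : (transfer S.C H S.B fun _ => 1) = S.C * S.B := by
    have := transfer_pow S.C hH hA S.B 0
    simpa using this
  have h2 : ∑ k ∈ Finset.range n, mulV (transfer S.C H S.B fun l => D l ^ k * (D l - 1))
        (lag u (s + 1) (2 + k)) =
      ∑ k ∈ Finset.range s, mulV (transfer S.C H S.B fun l => D l ^ k * (D l - 1))
        (u (s - 1 - k)) := by
    symm
    refine (Finset.sum_congr rfl fun k hk => ?_).trans
      (Finset.sum_subset (Finset.range_mono hs) fun k _ hk => ?_)
    · have := Finset.mem_range.1 hk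
      rw [lag, if_pos (by omega)]
      congr 2
      omega
    · have : ¬ (k < s) := by simpa using hk
      rw [lag, if_neg (by omega), mulV_zero]
  rw [h1, h2]
  unfold LDS.output
  rw [← mulV_sub, S.state_succ_sub]
  simp only [transfer_pow_mul_sub_one S.C hH hA, sub_mulV, mul_mulV, mulV_add, mulV_sub, mulV_sum,
    mulV_colMat]

/-! ### The comparator weights -/

section Comparator

variable {d n : ℕ}

/-- The contribution to `λᵏ (λ - 1)` of the eigenvalues outside `[0, 1]`. -/
def fastPart (D : Fin d → ℂ) (k : ℕ) (l : Fin d) : ℂ :=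
  open Classical in
  if D l ∈ Complex.ofReal '' Set.Icc 0 1 then 0 else D l ^ k * (D l - 1)

/-- The coefficient of the filter `ψ` in `λᵏ (λ - 1)`, for the eigenvalues in `[0, 1]`. -/
def slowCoeff (D : Fin d → ℂ) (ψ : Vec n) (l : Fin d) : ℂ :=
  open Classical in
  if D l ∈ Complex.ofReal '' Set.Icc 0 1 then ((-gen ψ (D l).re : ℝ) : ℂ) else 0

/-- The eigenvalue `1` counts as a point of `[0, 1]`, so what remains is in the disc. -/
lemma norm_le_of_mem_spectralRegion {ρ γ : ℝ} (hρ : 0 ≤ ρ) {z : ℂ} (hz : z ∈ spectralRegion ρ γ)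
    (hz' : z ∉ Complex.ofReal '' Set.Icc 0 1) : ‖z‖ ≤ 1 - γ := by
  rcases hz with (⟨x, hx, rfl⟩ | h1) | h
  · exact absurd ⟨x, ⟨hx.1, by linarith [hx.2]⟩, rfl⟩ hz'
  · refine absurd ⟨1, by simp, ?_⟩ hz'
    rw [Set.mem_singleton_iff.1 h1]; simp
  · exact h

lemma norm_pow_mul_sub_one_le {γ : ℝ} (hγ : 0 ≤ γ) {z : ℂ} (hz : ‖z‖ ≤ 1 - γ) (k : ℕ) :
    ‖z ^ k * (z - 1)‖ ≤ 2 * (1 - γ) ^ k := by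
  rw [norm_mul, norm_pow, mul_comm]
  have h1 : ‖z - 1‖ ≤ 2 := by
    refine (norm_sub_le _ _).trans ?_
    rw [norm_one]; linarith
  gcongr

lemma norm_fastPart_le {ρ γ : ℝ} (hρ : 0 ≤ ρ) (hγ : 0 ≤ γ) (hγ1 : γ ≤ 1) {D : Fin d → ℂ}
    (hD : ∀ l, D l ∈ spectralRegion ρ γ) (k : ℕ) (l : Fin d) :
    ‖fastPart D k l‖ ≤ 2 * (1 - γ) ^ k := by
  unfold fastPart
  split_ifs with h
  · rw [norm_zero]
    have := sub_nonneg.2 hγ1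
    positivity
  · exact norm_pow_mul_sub_one_le hγ (norm_le_of_mem_spectralRegion hρ (hD l) h) k

lemma norm_slowCoeff_pow_le {σ : Fin n → ℝ} {φ : Fin n → Vec n} (hF : IsFilterBank n σ φ)
    (D : Fin d → ℂ) (i : Fin n) (l : Fin d) : ‖slowCoeff D (φ i) l‖ ^ 4 ≤ 12 * σ i := by
  unfold slowCoeff
  split_ifs with h
  · obtain ⟨x, hx, hxl⟩ := h
    rw [← hxl, Complex.ofReal_re, Complex.norm_real, Real.norm_eq_abs, abs_neg]
    have : |gen (φ i) x| ^ 4 = gen (φ i) x ^ 4 := by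
      rw [← abs_pow, abs_of_nonneg (by positivity)]
    rw [this]
    exact hF.gen_pow_four_le i hx.1 hx.2
  · have := hF.nonneg i
    simp [this]

lemma norm_slowCoeff_le {σ : Fin n → ℝ} {φ : Fin n → Vec n} (hF : IsFilterBank n σ φ)
    (D : Fin d → ℂ) (i : Fin n) (l : Fin d) :
    ‖slowCoeff D (φ i) l‖ ≤ 2 * σ i ^ (1 / 4 : ℝ) := by
  have h0 := hF.nonneg i
  refine le_of_pow_le_pow_left₀ (n := 4) (by norm_num) (by positivity) ?_
  have : (σ i ^ (1 / 4 : ℝ)) ^ 4 = σ i := by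
    rw [← Real.rpow_natCast, ← Real.rpow_mul h0]
    norm_num
  rw [mul_pow, this]
  -- `12 ≤ 2⁴`.
  linarith [norm_slowCoeff_pow_le hF D i l]

/-- `n` orthonormal vectors in dimension `n` form an orthogonal matrix: orthonormal rows give
orthonormal columns. -/
lemma IsFilterBank.sum_mul {σ : Fin n → ℝ} {φ : Fin n → Vec n} (hF : IsFilterBank n σ φ)
    (k k' : Fin n) : ∑ i, φ i k * φ i k' = if k = k' then 1 else 0 := by
  let M : Matrix (Fin n) (Fin n) ℝ := Matrix.of fun i k => φ i k
  have h1 : M * M.transpose = 1 := by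
    ext i j
    have := orthonormal_iff_ite.1 hF.orthonormal j i
    rw [PiLp.inner_apply] at this
    rw [Matrix.mul_apply, Matrix.one_apply]
    simp only [eq_comm (a := i)]
    rw [← this]
    simp [M]
  have h3 : M.transpose * M = 1 := mul_eq_one_comm.1 h1
  have h2 := congrFun (congrFun h3 k) k'
  rw [Matrix.mul_apply, Matrix.one_apply] at h2
  simpa [M] using h2

lemma IsFilterBank.sum_mul_gen {σ : Fin n → ℝ} {φ : Fin n → Vec n} (hF : IsFilterBank n σ φ)
    (k : Fin n) (α : ℝ) : ∑ i, φ i k * gen (φ i) α = (1 - α) * α ^ (k : ℕ) := by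
  unfold gen
  simp_rw [Finset.mul_sum]
  rw [Finset.sum_comm]
  simp_rw [← mul_assoc, ← Finset.sum_mul, mul_assoc]
  simp_rw [hF.sum_mul]
  simp

/-- On `[0, 1]` this is the expansion of `-((1 - λ) λᵏ)ₖ` in the eigenbasis. It is exact; errors
enter only when filters are dropped. -/
lemma pow_mul_sub_one_eq {σ : Fin n → ℝ} {φ : Fin n → Vec n} (hF : IsFilterBank n σ φ)
    (D : Fin d → ℂ) (k : Fin n) :
    (fun l => D l ^ (k : ℕ) * (D l - 1)) =
      fastPart D k + ∑ i, φ i k • slowCoeff D (φ i) := by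
  ext l
  simp only [Pi.add_apply, Finset.sum_apply, Pi.smul_apply]
  unfold fastPart slowCoeff
  split_ifs with h
  · obtain ⟨x, hx, hxl⟩ := h
    rw [← hxl, Complex.ofReal_re, zero_add]
    have h1 := hF.sum_mul_gen k x
    have h2 : ∑ i, φ i k • ((-gen (φ i) x : ℝ) : ℂ) = ((-(∑ i, φ i k * gen (φ i) x) : ℝ) : ℂ) := by
      push_cast
      rw [← Finset.sum_neg_distrib]
      exact Finset.sum_congr rfl fun i _ => by rw [Complex.real_smul]; ring
    rw [h2, h1]
    push_cast
    ring
  · simp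

variable {T h m din dout : ℕ}

/-- The learned weights that imitate a linear dynamical system with eigenvalues `D` and transfer
functional `tr`. -/
def comparator (σ : Fin (T - 1) → ℝ) (φ : Fin (T - 1) → Vec (T - 1))
    (tr : (Fin d → ℂ) →ₗ[ℝ] Matrix (Fin dout) (Fin din) ℝ) (D : Fin d → ℂ) :
    Learned T h m din dout :=
  WithLp.toLp 2 fun p => Sum.elim
    (fun j : Fin (m - 1) => if (j : ℕ) = 0 then tr (fun _ => 1) else tr (fastPart D ((j : ℕ) - 1)))
    (fun i : Fin (numFilters T h) => (σ (i.castLE (min_le_right _ _)) ^ (1 / 4 : ℝ))⁻¹ •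
      tr (slowCoeff D (φ (i.castLE (min_le_right _ _))))) p.1 p.2.1 p.2.2

variable {σ : Fin (T - 1) → ℝ} {φ : Fin (T - 1) → Vec (T - 1)}
  {tr : (Fin d → ℂ) →ₗ[ℝ] Matrix (Fin dout) (Fin din) ℝ} {D : Fin d → ℂ}

lemma frob_smul {p q : ℕ} (c : ℝ) (M : Matrix (Fin p) (Fin q) ℝ) :
    frob (c • M) = |c| * frob M := by
  unfold frob
  rw [← Real.sqrt_sq_eq_abs, ← Real.sqrt_mul (sq_nonneg c)]
  simp [mul_pow, Finset.mul_sum]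

lemma norm_comparator_sq_le (hF : IsFilterBank (T - 1) σ φ) {ρ γ Y : ℝ} (hρ : 0 ≤ ρ) (hγ : 0 ≤ γ)
    (hγ1 : γ ≤ 1) (hD : ∀ l, D l ∈ spectralRegion ρ γ) (hY : 0 ≤ Y)
    (htr : ∀ f s, 0 ≤ s → (∀ l, ‖f l‖ ≤ s) → frob (tr f) ≤ Y * s) :
    ‖(comparator σ φ tr D : Learned T h m din dout)‖ ^ 2 ≤ (m + h) * (2 * Y) ^ 2 := by
  rw [norm_sq_eq_sum_frob]
  have h1 : ∀ c, frob (block (comparator σ φ tr D : Learned T h m din dout) c) ^ 2 ≤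
      (2 * Y) ^ 2 := by
    intro c
    refine pow_le_pow_left₀ (frob_nonneg _) ?_ 2
    rcases c with j | i
    · change frob (if (j : ℕ) = 0 then tr (fun _ => 1) else tr (fastPart D ((j : ℕ) - 1))) ≤ _
      split_ifs
      · refine (htr _ 1 zero_le_one fun l => by simp).trans ?_
        linarith
      · refine (htr _ 2 (by norm_num) fun l => ?_).trans (by linarith)
        refine (norm_fastPart_le hρ hγ hγ1 hD _ l).trans ?_
        have : (1 - γ) ^ ((j : ℕ) - 1) ≤ 1 := pow_le_one₀ (by linarith) (by linarith)
        linarith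
    · change frob ((σ (i.castLE (min_le_right _ _)) ^ (1 / 4 : ℝ))⁻¹ •
        tr (slowCoeff D (φ (i.castLE (min_le_right _ _))))) ≤ _
      generalize i.castLE (min_le_right _ _) = l
      have hσ : 0 ≤ σ l ^ (1 / 4 : ℝ) := Real.rpow_nonneg (hF.nonneg l) _
      rw [frob_smul, abs_of_nonneg (inv_nonneg.2 hσ)]
      have h2 := htr (slowCoeff D (φ l)) (2 * σ l ^ (1 / 4 : ℝ)) (by positivity)
        (norm_slowCoeff_le hF D l)
      rcases hσ.eq_or_lt with h0 | h0
      · rw [← h0, inv_zero, zero_mul]; positivity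
      · rw [inv_mul_le_iff₀ h0]
        linarith
  have h3 : ((m - 1 : ℕ) : ℝ) ≤ m := by exact_mod_cast Nat.sub_le _ _
  have h4 : ((numFilters T h : ℕ) : ℝ) ≤ h := by exact_mod_cast min_le_left _ _
  calc _ ≤ ∑ _c : Fin (m - 1) ⊕ Fin (numFilters T h), (2 * Y) ^ 2 :=
        Finset.sum_le_sum fun c _ => h1 c
    _ = (((m - 1 : ℕ) : ℝ) + ((numFilters T h : ℕ) : ℝ)) * (2 * Y) ^ 2 := by
        rw [Finset.sum_const, Finset.card_univ, Fintype.card_sum, Fintype.card_fin,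
          Fintype.card_fin, nsmul_eq_mul]
        push_cast; ring
    _ ≤ _ := by gcongr

lemma sum_castLE_eq {M : Type*} [AddCommMonoid M] {a n : ℕ} (han : a ≤ n) (g : Fin n → M) :
    ∑ i : Fin a, g (i.castLE han) = ∑ i : Fin n, if (i : ℕ) < a then g i else 0 := by
  rw [← Finset.sum_filter]
  refine Finset.sum_bij (fun i _ => i.castLE han) (by simp)
    (fun i _ j _ hij => Fin.castLE_injective han hij) (fun i hi => ?_) (fun _ _ => rfl)
  exact ⟨⟨i, (Finset.mem_filter.1 hi).2⟩, Finset.mem_univ _, rfl⟩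

lemma sum_range_eq_ite {M : Type*} [AddCommMonoid M] (a n : ℕ) (g : ℕ → M)
    (hg : ∀ k, n ≤ k → g k = 0) :
    ∑ k ∈ Finset.range a, g k = ∑ k ∈ Finset.range n, if k < a then g k else 0 := by
  rw [← Finset.sum_filter]
  symm
  refine Finset.sum_subset (fun k hk => ?_) (fun k hk hk' => hg k ?_)
  · simp at hk ⊢; exact hk.2
  · simp at hk hk'; omega

/-- The comparator weights reproduce the response to the inputs up to the truncations. -/
lemma response_sub_learnedPart_eq (hF : IsFilterBank (T - 1) σ φ) (hm : 2 ≤ m) (u : ℕ → Vec din)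
    {s : ℕ} (hs : s ≤ T - 1) :
    mulV (tr fun _ => 1) (u s) + ∑ k ∈ Finset.range (T - 1),
        mulV (tr fun l => D l ^ k * (D l - 1)) (lag u (s + 1) (2 + k)) -
      learnedPart σ φ u (s + 1) (comparator σ φ tr D : Learned T h m din dout) =
    (∑ k ∈ Finset.range (T - 1), if k < m - 2 then 0 else
        mulV (tr (fastPart D k)) (lag u (s + 1) (2 + k))) +
      ∑ i : Fin (T - 1), if (i : ℕ) < numFilters T h then 0 else
        mulV (tr (slowCoeff D (φ i))) (filtered (φ i) u (s + 1) 2) := by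
  have e1 : ∑ k ∈ Finset.range (T - 1),
        mulV (tr fun l => D l ^ k * (D l - 1)) (lag u (s + 1) (2 + k)) =
      (∑ k ∈ Finset.range (T - 1), mulV (tr (fastPart D k)) (lag u (s + 1) (2 + k))) +
      ∑ i, mulV (tr (slowCoeff D (φ i))) (filtered (φ i) u (s + 1) 2) := by
    rw [← Fin.sum_univ_eq_sum_range (fun k => mulV (tr fun l => D l ^ k * (D l - 1))
      (lag u (s + 1) (2 + k))), ← Fin.sum_univ_eq_sum_range (fun k => mulV (tr (fastPart D k))
      (lag u (s + 1) (2 + k)))]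
    have : ∑ i, mulV (tr (slowCoeff D (φ i))) (filtered (φ i) u (s + 1) 2) =
        ∑ k : Fin (T - 1), mulV (tr (∑ i, φ i k • slowCoeff D (φ i))) (lag u (s + 1) (2 + k)) := by
      simp only [filtered, mulV_sum, map_sum, map_smul, sum_mulV, mulV_smul, smul_mulV]
      rw [Finset.sum_comm]
    rw [this, ← Finset.sum_add_distrib]
    refine Finset.sum_congr rfl fun k _ => ?_
    rw [pow_mul_sub_one_eq hF, map_add, add_mulV]
  have e2 : learnedPart σ φ u (s + 1) (comparator σ φ tr D : Learned T h m din dout) =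
      (mulV (tr fun _ => 1) (u s) +
        ∑ k ∈ Finset.range (m - 2), mulV (tr (fastPart D k)) (lag u (s + 1) (2 + k))) +
      ∑ i : Fin (numFilters T h), mulV (tr (slowCoeff D (φ (i.castLE (min_le_right _ _)))))
        (filtered (φ (i.castLE (min_le_right _ _))) u (s + 1) 2) := by
    unfold learnedPart
    rw [Fintype.sum_sum_type]
    congr 1
    · have h1 : ∀ j : Fin (m - 1),
          mulV (block (comparator σ φ tr D : Learned T h m din dout) (Sum.inl j))
            (feature σ φ u (s + 1) (Sum.inl j : Fin (m - 1) ⊕ Fin (numFilters T h))) =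
          mulV (if (j : ℕ) = 0 then tr (fun _ => 1) else tr (fastPart D ((j : ℕ) - 1)))
            (lag u (s + 1) ((j : ℕ) + 1)) := fun j => rfl
      simp_rw [h1]
      rw [Fin.sum_univ_eq_sum_range (fun j => mulV (if j = 0 then tr (fun _ => 1) else
        tr (fastPart D (j - 1))) (lag u (s + 1) (j + 1))) (m - 1)]
      -- Of the `m - 1` regression matrices the first carries `C B`; the other `m - 2` carry the
      -- fast kernel.
      have hm' : m - 1 = (m - 2) + 1 := by omega
      rw [hm', Finset.sum_range_succ', add_comm]
      congr 1
      refine Finset.sum_congr rfl fun k _ => ?_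
      rw [if_neg (by omega)]
      congr 2
      omega
    · refine Finset.sum_congr rfl fun i _ => ?_
      change mulV ((σ (i.castLE (min_le_right _ _)) ^ (1 / 4 : ℝ))⁻¹ •
        tr (slowCoeff D (φ (i.castLE (min_le_right _ _)))))
        ((σ (i.castLE (min_le_right _ _))) ^ (1 / 4 : ℝ) •
          filtered (φ (i.castLE (min_le_right _ _))) u (s + 1) 2) = _
      generalize i.castLE (min_le_right _ _) = l
      rw [smul_mulV, mulV_smul, smul_smul]
      -- If `σ` vanishes, the inverse is `0` by convention, and the coefficient that it should
      -- restore is zero too.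
      by_cases h0 : σ l ^ (1 / 4 : ℝ) = 0
      · have h1 : slowCoeff D (φ l) = 0 := by
          ext a
          have := norm_slowCoeff_le hF D l a
          rw [h0, mul_zero] at this
          exact norm_le_zero_iff.1 this
        rw [h1, map_zero, zero_mulV, smul_zero]
      · rw [inv_mul_cancel₀ h0, one_smul]
  -- Nothing orders `m - 2` and `T - 1`, but from `k = T - 1` on the lag `2 + k` exceeds `s + 1` and
  -- the terms vanish.
  rw [e1, e2, sum_castLE_eq (min_le_right _ _) fun i =>
    mulV (tr (slowCoeff D (φ i))) (filtered (φ i) u (s + 1) 2),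
    sum_range_eq_ite (m - 2) (T - 1) (fun k => mulV (tr (fastPart D k)) (lag u (s + 1) (2 + k)))
      fun k hk => by rw [lag, if_neg (by omega), mulV_zero]]
  have e3 : ∀ (g : ℕ → Vec dout), ∑ k ∈ Finset.range (T - 1), (if k < m - 2 then 0 else g k) =
      ∑ k ∈ Finset.range (T - 1), g k -
        ∑ k ∈ Finset.range (T - 1), if k < m - 2 then g k else 0 := by
    intro g
    rw [← Finset.sum_sub_distrib]
    refine Finset.sum_congr rfl fun k _ => ?_
    split_ifs <;> simp
  have e4 : ∀ (g : Fin (T - 1) → Vec dout),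
      ∑ i : Fin (T - 1), (if (i : ℕ) < numFilters T h then 0 else g i) =
      ∑ i, g i - ∑ i : Fin (T - 1), if (i : ℕ) < numFilters T h then g i else 0 := by
    intro g
    rw [← Finset.sum_sub_distrib]
    refine Finset.sum_congr rfl fun k _ => ?_
    split_ifs <;> simp
  rw [e3, e4]
  abel

lemma norm_response_sub_learnedPart_le (hF : IsFilterBank (T - 1) σ φ) (hm : 2 ≤ m)
    {u : ℕ → Vec din} {s : ℕ} (hs : s ≤ T - 1) {ρ γ Y R ε : ℝ} (hρ : 0 ≤ ρ) (hγ : 0 ≤ γ)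
    (hγ1 : γ ≤ 1) (hD : ∀ l, D l ∈ spectralRegion ρ γ) (hY : 0 ≤ Y) (hR : 0 ≤ R) (hε : 0 ≤ ε)
    (htr : ∀ f s, 0 ≤ s → (∀ l, ‖f l‖ ≤ s) → frob (tr f) ≤ Y * s)
    (hu : ∀ t ≤ s + 1, ‖u t‖ ≤ R) (hσ : ∀ i : Fin (T - 1), h ≤ (i : ℕ) → 12 * σ i ≤ ε ^ 4) :
    ‖mulV (tr fun _ => 1) (u s) + ∑ k ∈ Finset.range (T - 1),
        mulV (tr fun l => D l ^ k * (D l - 1)) (lag u (s + 1) (2 + k)) -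
      learnedPart σ φ u (s + 1) (comparator σ φ tr D : Learned T h m din dout)‖ ≤
    Y * R * (T * (2 * (1 - γ) ^ (m - 2)) + T ^ 2 * ε) := by
  have hg := sub_nonneg.2 hγ1
  have hT : ((T - 1 : ℕ) : ℝ) ≤ T := by exact_mod_cast Nat.sub_le _ _
  rw [response_sub_learnedPart_eq hF hm u hs]
  have b1 : ‖∑ k ∈ Finset.range (T - 1), if k < m - 2 then 0 else
        mulV (tr (fastPart D k)) (lag u (s + 1) (2 + k))‖ ≤
      T * (Y * (2 * (1 - γ) ^ (m - 2)) * R) := by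
    refine (norm_sum_le _ _).trans ?_
    calc _ ≤ ∑ _k ∈ Finset.range (T - 1), Y * (2 * (1 - γ) ^ (m - 2)) * R := by
          refine Finset.sum_le_sum fun k _ => ?_
          split_ifs with hk
          · rw [norm_zero]; positivity
          · refine (norm_mulV_le _ _).trans ?_
            have h1 := htr (fastPart D k) (2 * (1 - γ) ^ (m - 2)) (by positivity) fun l => by
              refine (norm_fastPart_le hρ hγ hγ1 hD k l).trans ?_
              have := pow_le_pow_of_le_one hg (by linarith) (not_lt.1 hk)
              linarith
            exact mul_le_mul h1 (norm_lag_le hR hu _) (norm_nonneg _) (by positivity)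
      _ ≤ _ := by
          rw [Finset.sum_const, Finset.card_range, nsmul_eq_mul]
          gcongr
  have b2 : ‖∑ i : Fin (T - 1), if (i : ℕ) < numFilters T h then 0 else
        mulV (tr (slowCoeff D (φ i))) (filtered (φ i) u (s + 1) 2)‖ ≤ T * (Y * ε * (T * R)) := by
    refine (norm_sum_le _ _).trans ?_
    calc _ ≤ ∑ _i : Fin (T - 1), Y * ε * (T * R) := by
          refine Finset.sum_le_sum fun i _ => ?_
          split_ifs with hi
          · rw [norm_zero]; positivity
          · refine (norm_mulV_le _ _).trans ?_
            have hhi : h ≤ (i : ℕ) := by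
              have := i.2
              simp only [lt_min_iff, not_and_or, not_lt] at hi
              omega
            have h1 := htr (slowCoeff D (φ i)) ε hε fun l =>
              le_of_pow_le_pow_left₀ (n := 4) (by norm_num) hε
                ((norm_slowCoeff_pow_le hF D i l).trans (hσ i hhi))
            have h2 : ∑ k, |φ i k| ≤ T := by
              have h3 := sum_abs_le_sqrt_mul_norm (φ i)
              rw [hF.orthonormal.norm_eq_one i, one_pow, mul_one] at h3
              have hT1 : (1 : ℝ) ≤ T := by
                have := i.2
                exact_mod_cast (by omega : 1 ≤ T)
              nlinarith
            refine mul_le_mul h1 ((norm_filtered_le _ hR hu _).trans ?_) (norm_nonneg _)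
              (by positivity)
            exact mul_le_mul_of_nonneg_right h2 hR
      _ ≤ _ := by
          rw [Finset.sum_const, Finset.card_univ, Fintype.card_fin, nsmul_eq_mul]
          gcongr
  refine (norm_add_le _ _).trans ((add_le_add b1 b2).trans (le_of_eq ?_))
  ring

end Comparator

/-! ### Parameter estimates -/

lemma log_two_le_log {T : ℕ} (hT : 2 ≤ T) : (0.69 : ℝ) ≤ Real.log T := by
  have h1 : Real.log 2 ≤ Real.log T := Real.log_le_log (by norm_num) (by exact_mod_cast hT)
  linarith [Real.log_two_gt_d9]

lemma log_le_log_div {T : ℕ} (hT : 2 ≤ T) {γ : ℝ} (hγ : 0 < γ) (hγ1 : γ ≤ 1) :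
    Real.log T ≤ Real.log (T / γ) := by
  have h0 : (0 : ℝ) < T := by positivity
  refine Real.log_le_log h0 ?_
  rw [le_div_iff₀ hγ]
  nlinarith

lemma one_sub_pow_le {T m : ℕ} (hT : 2 ≤ T) {γ : ℝ} (hγ : 0 < γ) (hγ1 : γ ≤ 1) (hm2 : 2 ≤ m)
    (hm : 100 * (1 / γ * Real.log (T / γ)) ≤ m) : (1 - γ) ^ (m - 2) ≤ 8 / (T : ℝ) ^ 2 := by
  have h0 : (0 : ℝ) < T := by positivity
  have h1 := log_two_le_log hT
  have h2 := log_le_log_div hT hγ hγ1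
  have h3 : 100 * Real.log (T / γ) ≤ m * γ := by
    have := mul_le_mul_of_nonneg_right hm hγ.le
    calc _ = 100 * (1 / γ * Real.log (T / γ)) * γ := by field_simp
      _ ≤ _ := this
  have h4 : (1 - γ) ^ (m - 2) ≤ Real.exp (-γ) ^ (m - 2) :=
    pow_le_pow_left₀ (by linarith) (by linarith [Real.add_one_le_exp (-γ)]) _
  refine h4.trans ?_
  rw [← Real.exp_nat_mul, Nat.cast_sub hm2]
  -- The two missing lags cost at most `e² ≤ 8`.
  have h5 : ((m : ℝ) - (2 : ℕ)) * -γ ≤ 2 - 2 * Real.log T := by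
    push_cast
    nlinarith
  refine (Real.exp_le_exp.2 h5).trans ?_
  have h6 : Real.exp (2 * Real.log T) = (T : ℝ) ^ 2 := by
    rw [mul_comm, Real.exp_mul, Real.exp_log h0]
    norm_cast
  rw [Real.exp_sub, h6]
  gcongr
  have : Real.exp 2 = Real.exp 1 ^ 2 := by rw [← Real.exp_nat_mul]; norm_num
  rw [this]
  have := Real.exp_one_lt_d9
  have := Real.exp_pos 1
  nlinarith

lemma IsFilterBank.truncated_eigenvalue_le {T h : ℕ} (hT : 2 ≤ T) {σ : Fin (T - 1) → ℝ}
    {φ : Fin (T - 1) → Vec (T - 1)} (hF : IsFilterBank (T - 1) σ φ)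
    (hh : 100 * Real.log T ^ 2 ≤ h) (i : Fin (T - 1)) (hi : h ≤ (i : ℕ)) :
    12 * σ i ≤ (3 / (T : ℝ) ^ 3) ^ 4 := by
  have h0 : (0 : ℝ) < T := by positivity
  have h1 := log_two_le_log hT
  set J := Nat.sqrt h with hJ
  have h2 : σ i ≤ ((T - 1 : ℕ) : ℝ) * (1 / 4) ^ J :=
    hF.eigenvalue_le i ((Nat.sqrt_le h).trans hi)
  have h3 : 10 * Real.log T ≤ (J : ℝ) + 1 := by
    have h4 : (h : ℝ) ≤ ((J : ℝ) + 1) ^ 2 := by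
      have := (Nat.lt_succ_sqrt h).le
      rw [sq]
      exact_mod_cast this
    refine le_of_sq_le_sq ?_ (by positivity)
    nlinarith
  -- `10 log 4 ≥ 13`. One power of `T` pays for the factor `n` in the eigenvalue bound, and twelve
  -- give `(T³)⁴`; finally `12 · 4 ≤ 3⁴`.
  have h5 : (T : ℝ) ^ 13 ≤ 4 ^ (J + 1) := by
    have e4 : (4 : ℝ) = Real.exp (Real.log 4) := (Real.exp_log (by norm_num)).symm
    have l4 : (1.38 : ℝ) ≤ Real.log 4 := by
      have : Real.log 4 = 2 * Real.log 2 := by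
        rw [← Real.log_rpow (by norm_num)]; norm_num
      rw [this]; linarith [Real.log_two_gt_d9]
    have eT : (T : ℝ) ^ 13 = Real.exp (13 * Real.log T) := by
      rw [mul_comm, Real.exp_mul, Real.exp_log h0]
      norm_cast
    rw [eT, e4, ← Real.exp_nat_mul]
    refine Real.exp_le_exp.2 ?_
    push_cast
    nlinarith
  have h6 : ((1 : ℝ) / 4) ^ J ≤ 4 / (T : ℝ) ^ 13 := by
    rw [le_div_iff₀ (by positivity), div_pow, one_pow]
    rw [pow_succ (4 : ℝ)] at h5
    rw [div_mul_eq_mul_div, div_le_iff₀ (by positivity)]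
    linarith
  have h7 : ((T - 1 : ℕ) : ℝ) ≤ T := by exact_mod_cast Nat.sub_le _ _
  calc 12 * σ i ≤ 12 * (T * (4 / (T : ℝ) ^ 13)) := by
        refine mul_le_mul_of_nonneg_left (h2.trans ?_) (by norm_num)
        gcongr
    _ = 48 / (T : ℝ) ^ 12 := by field_simp; norm_num
    _ ≤ 81 / (T : ℝ) ^ 12 := by gcongr; norm_num
    _ = _ := by rw [div_pow, ← pow_mul]; norm_num

/-! ### Arithmetic of the parameters, with `ℓ = log T`, `L = log (T/γ)`, `X = R_B R_C κ`, `r = √T`,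
and `S` a bounded sum of step sizes. -/

section Arithmetic

variable {m h γ ℓ L c X R D η S r : ℝ}

lemma weight_count_le (hγ : 0 < γ) (hγ1 : γ ≤ 1) (hℓ : 0 < ℓ) (hℓL : ℓ ≤ L) (hL : 0.69 ≤ L)
    (hc : 1 ≤ c) (hh : h ≤ c * ℓ ^ 2) (hm : m ≤ c * (1 / γ * L)) :
    m + h ≤ 3 * c * (L ^ 2 / γ) := by
  have hγi : 1 ≤ 1 / γ := by rw [le_div_iff₀ hγ]; linarith
  have a1 : ℓ ^ 2 ≤ L ^ 2 * (1 / γ) := by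
    have : ℓ ^ 2 ≤ L ^ 2 := pow_le_pow_left₀ hℓ.le hℓL 2
    nlinarith [sq_nonneg L]
  have a2 : 1 / γ * L ≤ 2 * (L ^ 2 * (1 / γ)) := by
    have : L ≤ 2 * L ^ 2 := by nlinarith
    nlinarith
  calc m + h ≤ c * (2 * (L ^ 2 * (1 / γ))) + c * (L ^ 2 * (1 / γ)) := by
        refine add_le_add (hm.trans ?_) (hh.trans ?_) <;> gcongr
    _ = _ := by ring

lemma feature_count_le (hγ : 0 < γ) (hγ1 : γ ≤ 1) (hℓ : 0 < ℓ) (hℓL : ℓ ≤ L) (hL : 0.69 ≤ L)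
    (hc : 1 ≤ c) (hh : h ≤ c * ℓ ^ 2) (hm : m ≤ c * (1 / γ * L)) :
    m + h * (5 * (1 + ℓ) ^ 2) ≤ 49 * c * (L ^ 4 / γ) := by
  have hL0 : 0 < L := by linarith
  have hγi : 1 ≤ 1 / γ := by rw [le_div_iff₀ hγ]; linarith
  have a1 : 1 + ℓ ≤ 3 * L := by linarith
  have a2 : h * (5 * (1 + ℓ) ^ 2) ≤ (c * L ^ 2) * (5 * (3 * L) ^ 2) := by
    have : h ≤ c * L ^ 2 := hh.trans (by gcongr)
    gcongr
  have a5 : 1 ≤ 4 * L ^ 3 := by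
    have := pow_le_pow_left₀ (by norm_num) hL 3
    norm_num at this
    linarith
  have a3 : m ≤ c * (1 / γ * (4 * L ^ 4)) := by
    refine hm.trans ?_
    have : L ≤ 4 * L ^ 4 := by
      calc L = 1 * L := (one_mul L).symm
        _ ≤ 4 * L ^ 3 * L := by gcongr
        _ = _ := by ring
    gcongr
  have a4 : (c * L ^ 2) * (5 * (3 * L) ^ 2) ≤ 45 * c * (L ^ 4 / γ) := by
    calc _ = 45 * c * (L ^ 4 * 1) := by ring
      _ ≤ 45 * c * (L ^ 4 * (1 / γ)) := by gcongr
      _ = _ := by ring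
  calc _ ≤ c * (1 / γ * (4 * L ^ 4)) + 45 * c * (L ^ 4 / γ) := by linarith
    _ = _ := by ring

/-- The true order is `L⁴ ℓ ≤ L⁵`; the seventh power is slack, available because `L ≥ 0.69`. -/
lemma diameter_term_le (hγ : 0 < γ) (hℓ : 0 < ℓ) (hℓL : ℓ ≤ L) (hL : 0.69 ≤ L)
    (hc : 1 ≤ c) (hX : 0 < X) (hR : 0 < R) (hr : 0 < r) (hmh : m + h ≤ 3 * c * (L ^ 2 / γ))
    (hD0 : 0 ≤ D) (hD : D ≤ c * ((m + h) * X)) (hη : c⁻¹ * (X / (R * r * ℓ)) ≤ η) :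
    2 * D ^ 2 / η ≤ 54 * c ^ 5 * (L ^ 7 / γ ^ 2 * (X * R) * r) := by
  have hL0 : 0 < L := by linarith
  have hc0 : 0 < c := by linarith
  have hη0 : 0 < c⁻¹ * (X / (R * r * ℓ)) := by positivity
  have p : L ^ 4 * ℓ ≤ 3 * L ^ 7 := by
    have a : 1 ≤ 3 * L ^ 2 := by nlinarith
    calc L ^ 4 * ℓ ≤ L ^ 4 * L := by gcongr
      _ = L ^ 5 * 1 := by ring
      _ ≤ L ^ 5 * (3 * L ^ 2) := by gcongr
      _ = _ := by ring
  have hD' : D ≤ c * ((3 * c * (L ^ 2 / γ)) * X) := hD.trans (by gcongr)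
  calc 2 * D ^ 2 / η ≤ 2 * (c * ((3 * c * (L ^ 2 / γ)) * X)) ^ 2 /
        (c⁻¹ * (X / (R * r * ℓ))) := by gcongr
    _ = 18 * c ^ 5 * ((L ^ 4 * ℓ) / γ ^ 2 * (X * R) * r) := by
        field_simp; ring
    _ ≤ 18 * c ^ 5 * ((3 * L ^ 7) / γ ^ 2 * (X * R) * r) := by gcongr
    _ = _ := by ring

lemma gradient_term_le (hγ : 0 < γ) (hγ1 : γ ≤ 1) (hℓ : 0.69 ≤ ℓ) (hℓL : ℓ ≤ L)
    (hc : 1 ≤ c) (hX : 0 < X) (hR : 0 < R) (hr : 0 < r) {F : ℝ} (hF0 : 0 ≤ F)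
    (hF : F ≤ 49 * c * (L ^ 4 / γ)) (hS : S ≤ c * (X / (R * ℓ)) * (2 * r)) :
    R ^ 2 * F / 2 * S ≤ 245 * c ^ 2 * (L ^ 7 / γ ^ 2 * (X * R) * r) := by
  have hL0 : 0 < L := by linarith
  have hℓ0 : 0 < ℓ := by linarith
  have hc0 : 0 < c := by linarith
  have hi : 1 / ℓ ≤ 5 * L ^ 3 := by
    rw [div_le_iff₀ hℓ0]
    have h3 := pow_le_pow_left₀ (by norm_num) (hℓ.trans hℓL) 3
    norm_num at h3
    nlinarith
  have hγ2 : 1 / γ ≤ 1 / γ ^ 2 := one_div_le_one_div_of_le (by positivity) (by nlinarith)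
  calc _ ≤ R ^ 2 * F / 2 * (c * (X / (R * ℓ)) * (2 * r)) :=
        mul_le_mul_of_nonneg_left hS (by positivity)
    _ ≤ R ^ 2 * (49 * c * (L ^ 4 / γ)) / 2 * (c * (X / (R * ℓ)) * (2 * r)) := by
        gcongr
    _ = 49 * c ^ 2 * (L ^ 4 * (1 / ℓ) * (1 / γ) * (X * R) * r) := by
        field_simp
    _ ≤ 49 * c ^ 2 * (L ^ 4 * (5 * L ^ 3) * (1 / γ ^ 2) * (X * R) * r) := by
        gcongr
    _ = _ := by ring

end Arithmetic

/-- Absorbs lower-order errors into the main term; `14` makes up for `0.69⁷`. -/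
lemma one_le_log_factor {T : ℕ} {γ : ℝ} (hT : 2 ≤ T) (hγ : 0 < γ) (hγ1 : γ ≤ 1) :
    1 ≤ 14 * (Real.log (T / γ) ^ 7 / γ ^ 2 * √T) := by
  have h1 : (0.69 : ℝ) ^ 7 ≤ Real.log (T / γ) ^ 7 :=
    pow_le_pow_left₀ (by norm_num) ((log_two_le_log hT).trans (log_le_log_div hT hγ hγ1)) 7
  have h2 : 1 ≤ √(T : ℝ) := Real.one_le_sqrt.2 (by exact_mod_cast (by omega : 1 ≤ T))
  have h3 : 1 ≤ 1 / γ ^ 2 := by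
    rw [le_div_iff₀ (by positivity)]; nlinarith
  have h4 : 1 ≤ 14 * Real.log (T / γ) ^ 7 := by
    norm_num at h1 ⊢; linarith
  calc (1 : ℝ) = 1 * 1 * 1 := by norm_num
    _ ≤ (14 * Real.log (T / γ) ^ 7) * (1 / γ ^ 2) * √T := by gcongr
    _ = _ := by ring

/-! ### The comparator and the regret from an arbitrary starting time. -/

section Regret

variable {din dout T h m : ℕ} {ρ γ κ RB RC Rx R D c : ℝ} {η : ℕ → ℝ} {σ : Fin (T - 1) → ℝ}
  {φ : Fin (T - 1) → Vec (T - 1)} {u : ℕ → Vec din} {y : ℕ → Vec dout}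
  {w : ℕ → Learned T h m din dout} {S : LDS din dout}

/-- Learned weights whose loss exceeds that of the linear dynamical system only by the transient of
the initial state and a small truncation error. -/
lemma exists_comparator (hT : 2 ≤ T) (hγ : 0 < γ) (hγ1 : γ ≤ 1) (hρ : 0 ≤ ρ)
    (hκ : 0 ≤ κ) (hRB : 0 ≤ RB) (hRC : 0 ≤ RC) (hR : 0 < R)
    (hh : 100 * Real.log T ^ 2 ≤ h) (hm : 100 * (1 / γ * Real.log (T / γ)) ≤ m) (hm2 : 2 ≤ m)
    (hD : 100 * ((m + h) * (RB * RC * κ)) ≤ D) (hF : IsFilterBank (T - 1) σ φ)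
    (hu : ∀ t ≤ T, ‖u t‖ ≤ R) (hS : InClass T u y ρ γ κ RB RC Rx R S) :
    ∃ θ : Learned T h m din dout, ‖θ‖ ≤ D ∧ ∀ t ∈ Set.Icc 1 T, ∀ b : ℝ, 0 ≤ b →
      (∀ z ∈ spectralRegion ρ γ, ‖z ^ (t - 1) * (z - 1)‖ ≤ b) →
      loss σ φ u y t θ ≤
        ‖S.predict u y t - y t‖ + 2 * (RC * κ * Rx) * b + 38 * (RB * RC * κ * R) / T := by
  obtain ⟨H, Λ, hH, hA, hcond⟩ := exists_diagonalization S.A hκ hS.kappa_le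
  have hΛ : ∀ l, Λ l ∈ spectralRegion ρ γ := fun l =>
    hS.spectrum_subset (eigenvalue_mem_spectrum hH hA l)
  have hT0 : (0 : ℝ) < T := by positivity
  have hX : 0 ≤ RB * RC * κ := by positivity
  have hcond0 : 0 ≤ opNorm H * opNorm H⁻¹ := mul_nonneg (opNorm_nonneg _) (opNorm_nonneg _)
  set tr := transfer S.C H S.B with htrd
  have htr : ∀ f s, 0 ≤ s → (∀ l, ‖f l‖ ≤ s) → frob (tr f) ≤ 2 * (RB * RC * κ) * s := by
    intro f s hs hf
    refine (frob_transfer_le S.C H S.B f hs hf).trans ?_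
    calc _ ≤ RC * (2 * κ) * RB * s := by
          have := frob_nonneg S.C
          have := frob_nonneg S.B
          gcongr
          exacts [hS.C_le, hS.B_le]
      _ = _ := by ring
  refine ⟨comparator σ φ tr Λ, ?_, ?_⟩
  · have h1 := norm_comparator_sq_le (m := m) (h := h) hF hρ hγ.le hγ1 hΛ (by positivity) htr
    have hmh : (1 : ℝ) ≤ m + h := by
      have : (2 : ℝ) ≤ m := by exact_mod_cast hm2
      have : (0 : ℝ) ≤ h := by positivity
      linarith
    have hD0 : 0 ≤ (m + h) * (RB * RC * κ) := by positivity
    refine le_of_sq_le_sq (h1.trans ?_) (by linarith)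
    calc ((m : ℝ) + h) * (2 * (2 * (RB * RC * κ))) ^ 2
        ≤ (m + h) * (m + h) * (2 * (2 * (RB * RC * κ))) ^ 2 := by
          gcongr
          nlinarith
      _ = (4 * ((m + h) * (RB * RC * κ))) ^ 2 := by ring
      _ ≤ D ^ 2 := pow_le_pow_left₀ (by positivity) (by linarith) 2
  · rintro t ⟨ht1, htT⟩ b hb0 hb
    obtain ⟨s, rfl⟩ : ∃ s, t = s + 1 := ⟨t - 1, by omega⟩
    rw [Nat.add_sub_cancel] at hb
    have hsT : s ≤ T - 1 := by omega
    have h1 := norm_response_sub_learnedPart_le (tr := tr) (D := Λ) (m := m) (h := h)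
      (ε := 3 / (T : ℝ) ^ 3) hF hm2 hsT hρ hγ.le hγ1 hΛ (by positivity) hR.le (by positivity) htr
      (fun t ht => hu t (by omega)) (fun i hi => hF.truncated_eigenvalue_le hT hh i hi)
    have h2 : ‖mulV (transfer S.C H (colMat S.x₀) fun l => Λ l ^ s * (Λ l - 1)) unitVec‖ ≤
        2 * (RC * κ * Rx) * b := by
      refine (norm_mulV_le _ _).trans ?_
      rw [norm_unitVec, mul_one]
      refine (frob_transfer_le _ _ _ _ hb0 fun l => hb _ (hΛ l)).trans ?_
      rw [frob_colMat]
      calc _ ≤ RC * (2 * κ) * Rx * b := by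
            have := frob_nonneg S.C
            gcongr
            exacts [hS.C_le, hS.x₀_le]
        _ = _ := by ring
    -- `38 = 2 (2 · 8 + 3)`, from the geometric tail and the dropped filters.
    have h3 : 2 * (RB * RC * κ) * R *
        (T * (2 * (1 - γ) ^ (m - 2)) + T ^ 2 * (3 / (T : ℝ) ^ 3)) ≤
        38 * (RB * RC * κ * R) / T := by
      have := one_sub_pow_le hT hγ hγ1 hm2 hm
      calc _ ≤ 2 * (RB * RC * κ) * R * (T * (2 * (8 / (T : ℝ) ^ 2)) + T ^ 2 * (3 / (T : ℝ) ^ 3)) := by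
            gcongr
        _ = _ := by field_simp; ring
    have h4 := S.output_succ_sub u hH hA hsT
    have h5 : rawPrediction σ φ u y (comparator σ φ tr Λ : Learned T h m din dout).weights (s + 1) -
        y (s + 1) = (S.predict u y (s + 1) - y (s + 1)) -
        mulV (transfer S.C H (colMat S.x₀) fun l => Λ l ^ s * (Λ l - 1)) unitVec -
        (mulV (tr fun _ => 1) (u s) + ∑ k ∈ Finset.range (T - 1),
          mulV (tr fun l => Λ l ^ k * (Λ l - 1)) (lag u (s + 1) (2 + k)) -
          learnedPart σ φ u (s + 1) (comparator σ φ tr Λ : Learned T h m din dout)) := by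
      rw [rawPrediction_eq σ φ u y (by omega), LDS.predict, Nat.add_sub_cancel, h4, lag,
        if_pos (by omega), Nat.add_sub_cancel]
      abel
    unfold loss
    rw [h5]
    refine (norm_sub_le _ _).trans (add_le_add ((norm_sub_le _ _).trans ?_) (h1.trans h3))
    linarith

/-- Regret of the learned weights over the times `a, …, T`. -/
lemma sum_loss_sub_le (hT : 2 ≤ T) (hγ : 0 < γ) (hγ1 : γ ≤ 1) (hX : 0 ≤ RB * RC * κ)
    (hR : 0 < R) (hc : 1 ≤ c) (hh : h ≤ c * Real.log T ^ 2)
    (hm : m ≤ c * (1 / γ * Real.log (T / γ))) (hm2 : 2 ≤ m) (hD0 : 0 ≤ D)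
    (hD : D ≤ c * ((m + h) * (RB * RC * κ)))
    (hη : ∀ t : ℕ, 1 ≤ t → t ≤ T → c⁻¹ * (RB * RC * κ / (R * √t * Real.log T)) ≤ η t ∧
      η t ≤ c * (RB * RC * κ / (R * √t * Real.log T)))
    (hanti : AntitoneOn η (Set.Icc 1 T)) (hF : IsFilterBank (T - 1) σ φ)
    (hu : ∀ t ≤ T, ‖u t‖ ≤ R) (hw : IsRun σ φ u y D η w) {a : ℕ} (ha : 1 ≤ a) (haT : a ≤ T)
    {θ : Learned T h m din dout} (hθ : ‖θ‖ ≤ D) :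
    ∑ t ∈ Finset.Icc a T, (loss σ φ u y t (w t) - loss σ φ u y t θ) ≤
      (54 * c ^ 5 + 245 * c ^ 2) *
        (Real.log (T / γ) ^ 7 / γ ^ 2 * (RB * RC * κ * R) * √T) := by
  have hℓ := log_two_le_log hT
  have hℓL := log_le_log_div hT hγ hγ1
  have hwD : ∀ t, 1 ≤ t → t ≤ T → ‖w t‖ ≤ D := by
    intro t h1 hle
    obtain ⟨s, rfl⟩ : ∃ s, t = s + 1 := ⟨t - 1, by omega⟩
    rcases Nat.eq_zero_or_pos s with rfl | hs
    · exact hw.init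
    · obtain ⟨g, -, hg⟩ := hw.step s hs (by omega)
      rw [hg]
      exact norm_projBall_le hD0 _
  have hsqrt : ∀ t : ℕ, 1 ≤ t → 0 < √(t : ℝ) := fun t ht =>
    Real.sqrt_pos.2 (by exact_mod_cast ht)
  have hL0 : 0 < Real.log (T / γ) := by linarith
  have hℓ0 : 0 < Real.log T := by linarith
  -- If `R_B R_C κ = 0`, the step sizes vanish and the descent lemma does not apply; but then `D =
  -- 0`, and both weights are zero.
  rcases hX.eq_or_lt with h0 | hX
  · rw [← h0, mul_zero, mul_zero] at hD
    have hzero : ∀ t ∈ Finset.Icc a T, loss σ φ u y t (w t) - loss σ φ u y t θ = 0 := by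
      intro t ht
      obtain ⟨h1, h2⟩ := Finset.mem_Icc.1 ht
      have e1 : w t = 0 := norm_le_zero_iff.1 ((hwD t (by omega) h2).trans hD)
      have e2 : θ = 0 := norm_le_zero_iff.1 (hθ.trans hD)
      rw [e1, e2, sub_self]
    rw [Finset.sum_eq_zero hzero, ← h0]
    simp
  · set F : ℝ := m + h * (5 * (1 + Real.log T) ^ 2) with hFd
    have hF0 : 0 ≤ F := by positivity
    have hG : ∀ t ∈ Set.Icc a T,
        ∑ c, ‖(feature (m := m) (h := h) σ φ u t c : Vec din)‖ ^ 2 ≤ (R * √F) ^ 2 := by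
      intro t ht
      rw [mul_pow, Real.sq_sqrt hF0]
      exact sum_norm_feature_sq_le u hF hR.le fun s hs => hu s (hs.trans ht.2)
    -- The descent lemma asks of `w a` only that it lie in the ball, so the run can be entered at
    -- any time `a`.
    have hreg := online_descent_regret (f := fun t => loss (h := h) (m := m) σ φ u y t) (w := w)
      (η := η) (D := D) (G := R * √F) haT
      (fun t ht x z => loss_sub_le σ φ u y (by omega) x z t (by positivity) (hG t ht))
      (fun t ht => by
        have h1 := (hη t (ha.trans ht.1) ht.2).1
        have h2 := hsqrt t (ha.trans ht.1)
        exact lt_of_lt_of_le (by positivity) h1)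
      (hanti.mono (Set.Icc_subset_Icc_left ha))
      (fun t ht => hwD t (ha.trans ht.1) ht.2)
      (fun t h1 h2 => hw.step t (ha.trans h1) h2) hθ (by positivity)
    have hsum : ∑ t ∈ Finset.Icc a T, η t ≤
        c * (RB * RC * κ / (R * Real.log T)) * (2 * √T) := by
      calc ∑ t ∈ Finset.Icc a T, η t
          ≤ ∑ t ∈ Finset.Icc a T, c * (RB * RC * κ / (R * Real.log T)) * (1 / √(t : ℝ)) := by
            refine Finset.sum_le_sum fun t ht => ?_
            obtain ⟨h1, h2⟩ := Finset.mem_Icc.1 ht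
            refine (hη t (ha.trans h1) h2).2.trans (le_of_eq ?_)
            have := hsqrt t (ha.trans h1)
            field_simp
        _ = c * (RB * RC * κ / (R * Real.log T)) * ∑ t ∈ Finset.Icc a T, 1 / √(t : ℝ) := by
            rw [Finset.mul_sum]
        _ ≤ _ := by
            gcongr
            refine le_trans ?_ (sum_one_div_sqrt_le T)
            exact Finset.sum_le_sum_of_subset_of_nonneg (Finset.Icc_subset_Icc_left ha)
              fun t _ _ => by positivity
    have t1 := diameter_term_le hγ hℓ0 hℓL (hℓ.trans hℓL) hc hX hR (hsqrt T (by omega))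
      (weight_count_le hγ hγ1 hℓ0 hℓL (hℓ.trans hℓL) hc hh hm) hD0 hD
      (hη T (by omega) le_rfl).1
    have t2 := gradient_term_le hγ hγ1 hℓ hℓL hc hX hR (hsqrt T (by omega)) hF0
      (feature_count_le hγ hγ1 hℓ0 hℓL (hℓ.trans hℓL) hc hh hm) hsum
    have hsq : (R * √F) ^ 2 = R ^ 2 * F := by rw [mul_pow, Real.sq_sqrt hF0]
    rw [hsq] at hreg
    linarith

/-! ### Decay of the transient of the initial state. -/

lemma norm_pow_mul_sub_one_le_of_mem (hγ : 0 < γ) (hγ1 : γ ≤ 1) (hρ : 0 ≤ ρ)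
    {z : ℂ} (hz : z ∈ spectralRegion ρ γ) (s : ℕ) :
    ‖z ^ s * (z - 1)‖ ≤ 1 / ((s : ℝ) + 1) + 2 * (1 - γ) ^ s := by
  have hg := sub_nonneg.2 hγ1
  by_cases h : z ∈ Complex.ofReal '' Set.Icc 0 1
  · obtain ⟨x, hx, rfl⟩ := h
    have e : (x : ℂ) ^ s * ((x : ℂ) - 1) = ((x ^ s * (x - 1) : ℝ) : ℂ) := by push_cast; ring
    rw [e, Complex.norm_real, Real.norm_eq_abs, abs_mul, abs_of_nonneg (pow_nonneg hx.1 s),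
      abs_of_nonpos (by linarith [hx.2])]
    have h1 := mul_pow_pred_mul_one_sub_le hx.1 hx.2 (s + 1)
    rw [Nat.add_sub_cancel] at h1
    push_cast at h1
    have h2 : x ^ s * -(x - 1) ≤ 1 / ((s : ℝ) + 1) := by
      rw [le_div_iff₀ (by positivity)]
      linarith
    have : 0 ≤ 2 * (1 - γ) ^ s := by positivity
    linarith
  · have h1 := norm_pow_mul_sub_one_le hγ.le (norm_le_of_mem_spectralRegion hρ hz h) s
    have : 0 ≤ 1 / ((s : ℝ) + 1) := by positivity
    linarith

/-- The eigenvalue `1` contributes zero, and `ρ ≤ γ` puts all the others in the disc of radius `1 -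
ρ`. -/
lemma norm_pow_mul_sub_one_le_of_gap (hγ1 : γ ≤ 1) (hρ : 0 ≤ ρ) (hργ : ρ ≤ γ)
    {z : ℂ} (hz : z ∈ spectralRegion ρ γ) (s : ℕ) :
    ‖z ^ s * (z - 1)‖ ≤ 2 * (1 - ρ) ^ s := by
  have hg : 0 ≤ 1 - ρ := by linarith
  rcases hz with (⟨x, hx, rfl⟩ | h1) | h
  · refine norm_pow_mul_sub_one_le hρ ?_ s
    rw [Complex.norm_real, Real.norm_of_nonneg hx.1]
    exact hx.2
  · rw [Set.mem_singleton_iff.1 h1, sub_self, mul_zero, norm_zero]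
    positivity
  · exact norm_pow_mul_sub_one_le hρ (le_trans h (by linarith)) s

lemma sum_geometric_tail_le {q : ℝ} (hq : 0 ≤ q) (hq1 : q < 1) (t₀ T : ℕ) :
    ∑ t ∈ Finset.Icc (t₀ + 1) T, q ^ (t - 1) ≤ q ^ t₀ / (1 - q) := by
  have h1 : 0 < 1 - q := sub_pos.2 hq1
  rcases lt_or_ge T t₀ with h | h
  · rw [Finset.Icc_eq_empty (by omega), Finset.sum_empty]
    positivity
  have key : (∑ t ∈ Finset.Icc (t₀ + 1) T, q ^ (t - 1)) * (1 - q) = q ^ t₀ - q ^ T := by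
    induction T, h using Nat.le_induction with
    | base => simp
    | succ T h ih =>
      rw [Finset.sum_Icc_succ_top (by omega), add_mul, ih, Nat.add_sub_cancel]
      ring
  rw [le_div_iff₀ h1, key]
  linarith [pow_nonneg hq T]

lemma sum_one_div_add_le (hγ : 0 < γ) (hγ1 : γ ≤ 1) (hT : 2 ≤ T) :
    ∑ t ∈ Finset.Icc 1 T, (1 / (((t - 1 : ℕ) : ℝ) + 1) + 2 * (1 - γ) ^ (t - 1)) ≤
      3 * (1 / γ + Real.log T) := by
  rw [Finset.sum_add_distrib, ← Finset.mul_sum]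
  have h1 := sum_geometric_tail_le (q := 1 - γ) (by linarith) (by linarith) 0 T
  have h2 : ∑ t ∈ Finset.Icc 1 T, 1 / (((t - 1 : ℕ) : ℝ) + 1) ≤ 1 + Real.log T := by
    refine le_trans (le_of_eq ?_) (sum_one_div_le T)
    rw [Fin.sum_univ_eq_sum_range (fun k : ℕ => 1 / ((k : ℕ) + 1 : ℝ)) T, Finset.range_eq_Ico,
      ← Finset.Ico_succ_right_eq_Icc, Finset.sum_Ico_eq_sum_range, Finset.sum_Ico_eq_sum_range]
    simp
  have h3 : 1 ≤ 1 / γ := by rw [le_div_iff₀ hγ]; linarith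
  have h4 := log_two_le_log hT
  simp only [zero_add, pow_zero, sub_sub_cancel] at h1
  linarith

/-- Fixes the burn-in time: after `log₊(Z/R)/ρ` steps a transient of size `Z` has shrunk to `R`. -/
lemma mul_exp_neg_logPlus_le {Z : ℝ} (hZ : 0 ≤ Z) (hR : 0 < R) :
    Z * Real.exp (-logPlus (Z / R)) ≤ R := by
  rcases hZ.eq_or_lt with rfl | hZ
  · simpa using hR.le
  · have h1 : Real.exp (-logPlus (Z / R)) ≤ Real.exp (-Real.log (Z / R)) := by
      refine Real.exp_le_exp.2 (neg_le_neg ?_)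
      unfold logPlus
      linarith [le_max_right 0 (Real.log (Z / R))]
    rw [Real.exp_neg (Real.log _), Real.exp_log (by positivity)] at h1
    calc _ ≤ Z * (Z / R)⁻¹ := by gcongr
      _ = R := by field_simp

end Regret

section Regret

variable {din dout T h m : ℕ} {ρ γ κ RB RC Rx R D c : ℝ} {η : ℕ → ℝ} {σ : Fin (T - 1) → ℝ}
  {φ : Fin (T - 1) → Vec (T - 1)} {u : ℕ → Vec din} {y : ℕ → Vec dout}
  {w : ℕ → Learned T h m din dout} {S : LDS din dout}

/-- Regret over the times `a, …, T`, in terms of a bound on the decay of the transient. -/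
lemma sum_prediction_sub_le (hT : 2 ≤ T) (hγ : 0 < γ) (hγ1 : γ ≤ 1) (hρ : 0 ≤ ρ)
    (hκ : 0 ≤ κ) (hRB : 0 ≤ RB) (hRC : 0 ≤ RC) (hR : 0 < R) (hc : 100 ≤ c)
    (hh : 100 * Real.log T ^ 2 ≤ h) (hh' : h ≤ c * Real.log T ^ 2)
    (hm : 100 * (1 / γ * Real.log (T / γ)) ≤ m) (hm' : m ≤ c * (1 / γ * Real.log (T / γ)))
    (hD : 100 * ((m + h) * (RB * RC * κ)) ≤ D) (hD' : D ≤ c * ((m + h) * (RB * RC * κ)))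
    (hη : ∀ t : ℕ, 1 ≤ t → t ≤ T → c⁻¹ * (RB * RC * κ / (R * √t * Real.log T)) ≤ η t ∧
      η t ≤ c * (RB * RC * κ / (R * √t * Real.log T)))
    (hanti : AntitoneOn η (Set.Icc 1 T)) (hF : IsFilterBank (T - 1) σ φ)
    (hu : ∀ t ≤ T, ‖u t‖ ≤ R) (hy : ∀ t ≤ T, ‖y t‖ ≤ R) (hw : IsRun σ φ u y D η w)
    (hS : InClass T u y ρ γ κ RB RC Rx R S) {a : ℕ} (ha : 1 ≤ a) (haT : a ≤ T)
    {b : ℕ → ℝ} (hb0 : ∀ s, 0 ≤ b s)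
    (hb : ∀ s, ∀ z ∈ spectralRegion ρ γ, ‖z ^ s * (z - 1)‖ ≤ b s) :
    ∑ t ∈ Finset.Icc a T, (‖prediction σ φ u y R w t - y t‖ - ‖S.predict u y t - y t‖) ≤
      (54 * c ^ 5 + 245 * c ^ 2 + 532) *
        (Real.log (T / γ) ^ 7 / γ ^ 2 * (RB * RC * κ * R) * √T) +
      2 * (RC * κ * Rx) * ∑ t ∈ Finset.Icc a T, b (t - 1) := by
  have hX : 0 ≤ RB * RC * κ := by positivity
  have hT0 : (0 : ℝ) < T := by positivity
  have hm2 : 2 ≤ m := by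
    have h1 := (log_two_le_log hT).trans (log_le_log_div hT hγ hγ1)
    have h2 : 1 ≤ 1 / γ := by rw [le_div_iff₀ hγ]; linarith
    have h3 : (2 : ℝ) ≤ m := by nlinarith
    exact_mod_cast h3
  have hD0 : 0 ≤ D := le_trans (by positivity) hD
  obtain ⟨θ, hθ, hcomp⟩ := exists_comparator (σ := σ) (φ := φ) (y := y) (S := S) hT hγ hγ1 hρ hκ
    hRB hRC hR hh hm hm2 hD hF hu hS
  have hreg := sum_loss_sub_le hT hγ hγ1 hX hR (by linarith) hh' hm' hm2 hD0 hD' hη hanti hF hu hw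
    ha haT hθ
  have hterm : ∀ t ∈ Finset.Icc a T,
      ‖prediction σ φ u y R w t - y t‖ - ‖S.predict u y t - y t‖ ≤
      (loss σ φ u y t (w t) - loss σ φ u y t θ) + 2 * (RC * κ * Rx) * b (t - 1) +
        38 * (RB * RC * κ * R) / T := by
    intro t ht
    obtain ⟨h1, h2⟩ := Finset.mem_Icc.1 ht
    have h3 := norm_prediction_sub_le (σ := σ) (φ := φ) u y (hy t h2) w
    have h4 := hcomp t ⟨ha.trans h1, h2⟩ (b (t - 1)) (hb0 _) (hb (t - 1))
    linarith
  -- `532 = 38 · 14`, by `one_le_log_factor`.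
  have hconst : ∑ _t ∈ Finset.Icc a T, 38 * (RB * RC * κ * R) / T ≤
      532 * (Real.log (T / γ) ^ 7 / γ ^ 2 * (RB * RC * κ * R) * √T) := by
    have h1 : ((Finset.Icc a T).card : ℝ) ≤ T := by
      rw [Nat.card_Icc]
      exact_mod_cast (by omega : T + 1 - a ≤ T)
    have h2 := one_le_log_factor hT hγ hγ1
    rw [Finset.sum_const, nsmul_eq_mul]
    calc _ ≤ (T : ℝ) * (38 * (RB * RC * κ * R) / T) := by gcongr
      _ = 38 * (RB * RC * κ * R) * 1 := by field_simp
      _ ≤ 38 * (RB * RC * κ * R) * (14 * (Real.log (T / γ) ^ 7 / γ ^ 2 * √T)) := by gcongr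
      _ = _ := by ring
  refine (Finset.sum_le_sum hterm).trans ?_
  rw [Finset.sum_add_distrib, Finset.sum_add_distrib, ← Finset.mul_sum]
  linarith

end Regret

end OSF

end

/-! ### The regret bound. -/

theorem lemma3 :
    ∃ c₀ : ℝ, 1 ≤ c₀ ∧ ∀ c₁ : ℝ, c₀ ≤ c₁ → ∃ K : ℝ, 0 < K ∧
      ∀ (din dout T : ℕ) (ρ γ κ RB RC Rx R : ℝ),
        2 ≤ T → 0 < γ → γ ≤ 1 → 0 ≤ ρ → ρ ≤ γ →
        0 ≤ κ → 0 ≤ RB → 0 ≤ RC → 0 ≤ Rx → 0 < R →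
      ∀ (h m : ℕ) (D : ℝ) (η : ℕ → ℝ),
        -- `h = Θ(log² T)`
        c₀ * Real.log T ^ 2 ≤ h → h ≤ c₁ * Real.log T ^ 2 →
        -- `m = Θ(log (T / γ) / γ)`
        c₀ * (1 / γ * Real.log (T / γ)) ≤ m → m ≤ c₁ * (1 / γ * Real.log (T / γ)) →
        -- `D = Θ((m + h) R_B R_C κ)`
        c₀ * ((m + h) * (RB * RC * κ)) ≤ D → D ≤ c₁ * ((m + h) * (RB * RC * κ)) →
        -- `η_t = Θ(R_B R_C κ / (R √t log T))`, nonincreasing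
        (∀ t : ℕ, 1 ≤ t → t ≤ T →
          c₁⁻¹ * (RB * RC * κ / (R * √t * Real.log T)) ≤ η t ∧
          η t ≤ c₁ * (RB * RC * κ / (R * √t * Real.log T))) →
        AntitoneOn η (Set.Icc 1 T) →
      ∀ (σ : Fin (T - 1) → ℝ) (φ : Fin (T - 1) → OSF.Vec (T - 1)),
        OSF.IsFilterBank (T - 1) σ φ →
      ∀ (u : ℕ → OSF.Vec din) (y : ℕ → OSF.Vec dout),
        (∀ t ≤ T, ‖u t‖ ≤ R) → (∀ t ≤ T, ‖y t‖ ≤ R) →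
      ∀ w : ℕ → OSF.Learned T h m din dout,
        OSF.IsRun σ φ u y D η w →
      ∀ S : OSF.LDS din dout,
        OSF.InClass T u y ρ γ κ RB RC Rx R S →
        (0 < ρ →
          OSF.regret T u y (OSF.prediction σ φ u y R w) S ≤
            K * (Real.log (T / γ) ^ 7 / γ ^ 2 * (RB * RC * κ * R) * √T
              + R * OSF.logPlus (RC * κ * Rx / R) / ρ)) ∧
        (ρ = 0 →
          OSF.regret T u y (OSF.prediction σ φ u y R w) S ≤
            K * (Real.log (T / γ) ^ 7 / γ ^ 2 * (RB * RC * κ * R) * √T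
              + RC * κ * Rx * (1 / γ + Real.log T))) := by
  -- The constant comes from `sum_prediction_sub_le`; being at least `8`, it also covers the
  -- transient: `4 + 4` (burn-in and tail) for `ρ > 0`, and `2 · 3` for `ρ = 0`.
  refine ⟨100, by norm_num, fun c hc => ⟨54 * c ^ 5 + 245 * c ^ 2 + 532, by positivity, ?_⟩⟩
  intro din dout T ρ γ κ RB RC Rx R hT hγ hγ1 hρ hργ hκ hRB hRC hRx hR h m D η hh hh' hm hm' hD hD'
    hη hanti σ φ hF u y hu hy w hw S hS
  set K : ℝ := 54 * c ^ 5 + 245 * c ^ 2 + 532 with hK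
  have hK8 : 8 ≤ K := by
    have : 0 ≤ 54 * c ^ 5 + 245 * c ^ 2 := by positivity
    linarith
  have hL : 0 < Real.log (T / γ) := by
    linarith [OSF.log_two_le_log hT, OSF.log_le_log_div hT hγ hγ1]
  set M := Real.log (T / γ) ^ 7 / γ ^ 2 * (RB * RC * κ * R) * √T with hM
  have hM0 : 0 ≤ M := by positivity
  have hZ : 0 ≤ RC * κ * Rx := by positivity
  have hregret : OSF.regret T u y (OSF.prediction σ φ u y R w) S =
      ∑ t ∈ Finset.Icc 1 T,
        (‖OSF.prediction σ φ u y R w t - y t‖ - ‖S.predict u y t - y t‖) :=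
    Finset.sum_sub_distrib _ _ |>.symm
  rw [hregret]
  constructor
  · intro hρ0
    set Λ := OSF.logPlus (RC * κ * Rx / R) with hΛ
    have hΛ1 : 1 ≤ Λ := le_add_of_nonneg_right (le_max_left _ _)
    have hΛρ : 1 ≤ Λ / ρ := by rw [le_div_iff₀ hρ0]; linarith
    -- Length of the burn-in. As `Λ / ρ ≥ 1`, rounding up at most doubles it.
    set t₀ := ⌈Λ / ρ⌉₊ with ht₀
    have ht₀' : (t₀ : ℝ) ≤ 2 * (Λ / ρ) := by
      have := Nat.ceil_lt_add_one (show 0 ≤ Λ / ρ by linarith)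
      linarith
    have hcrude : ∀ t ∈ Finset.Icc 1 T,
        ‖OSF.prediction σ φ u y R w t - y t‖ - ‖S.predict u y t - y t‖ ≤ 2 * R := by
      intro t ht
      have h1 := norm_sub_le (OSF.prediction σ φ u y R w t) (y t)
      have h2 : ‖OSF.prediction σ φ u y R w t‖ ≤ R := OSF.norm_projBall_le hR.le _
      have h3 := hy t (Finset.mem_Icc.1 ht).2
      have h4 := norm_nonneg (S.predict u y t - y t)
      linarith
    have hhead : ∀ a, a ≤ t₀ → a ≤ T → ∑ t ∈ Finset.Icc 1 a,
        (‖OSF.prediction σ φ u y R w t - y t‖ - ‖S.predict u y t - y t‖) ≤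
        4 * (R * Λ / ρ) := by
      intro a ha haT
      have h1 : (a : ℝ) ≤ t₀ := by exact_mod_cast ha
      calc _ ≤ ∑ _t ∈ Finset.Icc 1 a, 2 * R := Finset.sum_le_sum fun t ht =>
            hcrude t (Finset.Icc_subset_Icc_right haT ht)
        _ = (a : ℝ) * (2 * R) := by simp
        _ ≤ (2 * (Λ / ρ)) * (2 * R) := by gcongr; linarith
        _ = _ := by ring
    have hQ : 0 ≤ R * Λ / ρ := by positivity
    -- A horizon within the burn-in needs only the crude bound `2R` per step.
    rcases le_or_gt T t₀ with hle | hlt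
    · have := hhead T hle le_rfl
      have h7 := mul_le_mul_of_nonneg_right hK8 hQ
      have h8 := mul_nonneg (show 0 ≤ K by linarith) hM0
      rw [mul_add]
      linarith
    · have hq : 0 ≤ 1 - ρ := by linarith
      have h1 := OSF.sum_prediction_sub_le hT hγ hγ1 hρ hκ hRB hRC hR hc hh hh' hm hm' hD hD' hη
        hanti hF hu hy hw hS (a := t₀ + 1) (by omega) (by omega) (b := fun s => 2 * (1 - ρ) ^ s)
        (fun s => by positivity)
        (fun s z hz => OSF.norm_pow_mul_sub_one_le_of_gap hγ1 hρ hργ hz s)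
      have h2 := hhead t₀ le_rfl hlt.le
      have h3 := OSF.sum_geometric_tail_le hq (by linarith) t₀ T
      rw [sub_sub_cancel] at h3
      have h4 : (RC * κ * Rx) * (1 - ρ) ^ t₀ ≤ R := by
        refine le_trans ?_ (OSF.mul_exp_neg_logPlus_le hZ hR)
        refine mul_le_mul_of_nonneg_left ?_ hZ
        calc (1 - ρ) ^ t₀ ≤ Real.exp (-ρ) ^ t₀ :=
              pow_le_pow_left₀ hq (by linarith [Real.add_one_le_exp (-ρ)]) _
          _ = Real.exp (t₀ * -ρ) := (Real.exp_nat_mul _ _).symm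
          _ ≤ Real.exp (-Λ) := by
              refine Real.exp_le_exp.2 ?_
              have := (div_le_iff₀ hρ0).1 (Nat.le_ceil (Λ / ρ))
              linarith
      have h5 : 2 * (RC * κ * Rx) * ∑ t ∈ Finset.Icc (t₀ + 1) T, 2 * (1 - ρ) ^ (t - 1) ≤
          4 * (R * Λ / ρ) := by
        rw [← Finset.mul_sum]
        calc _ ≤ 2 * (RC * κ * Rx) * (2 * ((1 - ρ) ^ t₀ / ρ)) := by gcongr
          _ = 4 * (((RC * κ * Rx) * (1 - ρ) ^ t₀) / ρ) := by ring
          _ ≤ 4 * (R * Λ / ρ) := by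
              refine mul_le_mul_of_nonneg_left (div_le_div_of_nonneg_right (h4.trans ?_) hρ0.le)
                (by norm_num)
              exact le_mul_of_one_le_right hR.le hΛ1
      have h6 : ∑ t ∈ Finset.Icc 1 T,
          (‖OSF.prediction σ φ u y R w t - y t‖ - ‖S.predict u y t - y t‖) =
          ∑ t ∈ Finset.Icc 1 t₀,
            (‖OSF.prediction σ φ u y R w t - y t‖ - ‖S.predict u y t - y t‖) +
          ∑ t ∈ Finset.Icc (t₀ + 1) T,
            (‖OSF.prediction σ φ u y R w t - y t‖ - ‖S.predict u y t - y t‖) := by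
        simp only [← Finset.Ico_succ_right_eq_Icc, Nat.succ_eq_succ, Nat.succ_eq_add_one]
        exact (Finset.sum_Ico_consecutive _ (by omega) (by omega)).symm
      rw [h6, mul_add]
      have h7 := mul_le_mul_of_nonneg_right hK8 hQ
      linarith
  · rintro rfl
    have hb : ∀ s : ℕ, 0 ≤ 1 / ((s : ℝ) + 1) + 2 * (1 - γ) ^ s := fun s => by
      have := sub_nonneg.2 hγ1
      positivity
    have h1 := OSF.sum_prediction_sub_le hT hγ hγ1 hρ hκ hRB hRC hR hc hh hh' hm hm' hD hD' hη
      hanti hF hu hy hw hS (a := 1) le_rfl (by omega) hb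
      (fun s z hz => OSF.norm_pow_mul_sub_one_le_of_mem hγ hγ1 le_rfl hz s)
    have h2 := OSF.sum_one_div_add_le hγ hγ1 hT
    have h3 := mul_le_mul_of_nonneg_left h2 (show 0 ≤ 2 * (RC * κ * Rx) by positivity)
    have h4 : 0 ≤ RC * κ * Rx * (1 / γ + Real.log T) := by positivity
    have h5 := mul_le_mul_of_nonneg_right hK8 h4
    rw [mul_add]
    linarith
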